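/- **Setting.** Fix a section length $L>0$, a green duration $G>0$ and a red duration $R\ge 0$ with cycle $C=G+R$, a speed limit $\bar v>0$, acceleration bounds $\underline a<0<\bar a$, a jam spacing $s>0$ and a delay $\tau\ge 0$. The signal at location $L$ is green on $\mathcal G=\bigcup_{m\ge 0}[mC,mC+G)$, and $G(t)=\min\{t'\in\mathcal G: t'\ge t\}$. A *trajectory* is a differentiable $p:\mathbb R\to\mathbb R$ whose velocity $\dot p$ is locally absolutely continuous and has one-sided derivatives everywhere, the right one $\ddot p$ being Riemann integrable on compact intervals. $\mathcal T$ is the set of trajectories with $0\le\dot p\le\bar v$ and $\underline a\le\ddot p\le\bar a$ everywhere. Vehicles $n=1,\dots,N$ have entry speeds $v_n$ and entry times $t_n$; $\mathcal T_n^-=\{p\in\mathcal T: p(t_n)=0,\ \dot p(t_n)=v_n\}$. The *feasible set* $\mathcal P$ consists of the vectors $(p_n)_{n\le N}$ with $p_n\in\mathcal T_n^-$, $\inf\{t:p_n(t)\ge L\}\in\mathcal G$ (with $\inf\emptyset=+\infty$) for all $n$, and $p_{n-1}(t-\tau)-p_n(t)\ge s$ for all $t\in\mathbb R$ and $n\ge2$.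 For a state point $(l,v,t_0)$ with $0\le v\le\bar v$, let $\bar p_{l,v,t_0}$ be the curve that is at rest until $t_0-v/\bar a$, then accelerates at rate $\bar a$ until $t_0+(\bar v-v)/\bar a$, then has speed $\bar v$; let $\underline p_{l,v,t_0}$ be the curve that has speed $\bar v$ until $t_0-(v-\bar v)/\underline a$, then has acceleration $\underline a$ until $t_0-v/\underline a$, then is at rest; both are at location $l$ with speed $v$ at time $t_0$. The entry boundary condition $[v_n,t_n]$ is *proper* if $v_n\in[0,\bar v]$ for all $n$ and, for all $m<n$, $$\inf_{t\in\mathbb R}\Big(\bar p_{(m-n)s,\;v_m,\;t_m+(n-m)\tau}(t)-\underline p_{0,\,v_n,\,t_n}(t)\Big)\ge 0 .$$ The entry separations are *sufficient for safety* if for every $n$ there are $p_k\in\mathcal T_k^-$, $k\le n$, with $p_{k-1}(t-\tau)-p_k(t)\ge s$ for all $2\le k\le n$ and all $t\le t_n$. **Shooting heuristic** $P^{SH}(\underline a^f,\bar a^f,\underline a^b,\bar a^b)$. The output for vehicle $n$ is a curve $p_n$ on $[t_n,\infty)$, computed for $n=1,\dots,N$ in turn; the heuristic has empty output as soon as one step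 fails. 1. *Forward shooting* from $(l,v,t_0)$ below a curve $b$: the template accelerates from $(l,v,t_0)$ at rate $\bar a^f$ up to speed $\bar v$ and then cruises. If there are $t_0\le t^m\le t^+$ such that the template on $[t_0,t^m]$ and the parabola of acceleration $\underline a^f$ leaving the template tangentially at $t^m$, on $[t^m,t^+]$, do not exceed $b$ where $b$ is defined, and this parabola is tangent to $b$ at $t^+$, the output follows the template to $t^m$, the parabola to $t^+$, and $b$ afterwards. Otherwise the output is the template if it never exceeds $b$ on $[t_0,\infty)$, and the step fails if it does. Without $b$ the output is the template. 2. Let $p_n^f$ be the forward shooting output from $(0,v_n,t_n)$ below the shadow $t\mapsto p_{n-1}(t-\tau)-s$ (without bound for $n=1$), and let $t^L$ be the first time at which $p_n^f\ge L$. If $t^L\in\mathcal G$, put $p_n=p_n^f$. 3. Otherwise shoot *backward* from $(L,\dot p_n^f(t^L),G(t^L))$: backwards in time the backward template loses speed at rate $\bar a^b$ down to $0$ and is at rest before that. If there are $t_n\le t^+\le t^m\le G(t^L)$ such that the backward template on $[t^m,G(t^L)]$ and the parabola of acceleration $\underline a^b$ tangent to it at $t^m$, on $[t^+,t^m]$,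 do not exceed $p_n^f$, this parabola is tangent to $p_n^f$ at $t^+$, and $p_n^f(t^+)\ge0$, then $p_n$ follows $p_n^f$ to $t^+$, the parabola to $t^m$, the backward template to $G(t^L)$, and then the forward shooting output from $(L,\dot p_n^f(t^L),G(t^L))$ below $p_n^f$. Otherwise the step fails. **Theorem.** Suppose $$L\ \ge\ \frac{\bar v^2}{2\bar a}+2\cdot\frac{\bar v^2}{-2\underline a}+s(N-1).$$ Then $\mathcal P\ne\emptyset$ if and only if $[v_n,t_n]$ is proper. If the entry separations are sufficient for safety, then moreover $P^{SH}(\underline a,\bar a,\underline a,\bar a)\neq\emptyset$ if and only if $\mathcal P\ne\emptyset$; that is, the three conditions $P^{SH}(\underline a,\bar a,\underline a,\bar a)\neq\emptyset$, $\mathcal P\neq\emptyset$ and "$[v_n,t_n]$ is proper" are then equivalent. -/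

import Mathlib

open Set

/-- The parameters of a signalized one-lane section: length `L`, green and red durations `G`, `R`,
speed limit, acceleration bounds `aMin < 0 < aMax`, jam spacing `s` and communication delay `τ`. -/
structure Highway where
  L : ℝ
  G : ℝ
  R : ℝ
  vMax : ℝ
  aMin : ℝ
  aMax : ℝ
  s : ℝ
  τ : ℝ
  L_pos : 0 < L
  G_pos : 0 < G
  R_nonneg : 0 ≤ R
  vMax_pos : 0 < vMax
  aMin_neg : aMin < 0
  aMax_pos : 0 < aMax
  s_pos : 0 < s
  τ_nonneg : 0 ≤ τ

/-- A state point: location, speed, time. -/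
structure StatePoint where
  loc : ℝ
  speed : ℝ
  time : ℝ

noncomputable section

/-- The acceleration of `p` at `t`: the right derivative of the velocity. -/
def acceleration (p : ℝ → ℝ) (t : ℝ) : ℝ :=
  derivWithin (deriv p) (Ici t) t

/-- A trajectory: a differentiable function whose velocity is (locally) absolutely continuous and
has one-sided derivatives everywhere, the right one being Riemann integrable on every compact
interval (Mathlib's box integral in dimension one, with Riemann's filter). -/
structure IsTrajectory (p : ℝ → ℝ) : Prop where
  differentiable : Differentiable ℝ p
  absolutelyContinuous : ∀ a b : ℝ, AbsolutelyContinuousOnInterval (deriv p) a b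
  semidifferentiable_right : ∀ t, DifferentiableWithinAt ℝ (deriv p) (Ici t) t
  semidifferentiable_left : ∀ t, DifferentiableWithinAt ℝ (deriv p) (Iic t) t
  riemannIntegrable : ∀ I : BoxIntegral.Box (Fin 1),
    BoxIntegral.Integrable I BoxIntegral.IntegrationParams.Riemann
      (fun x : Fin 1 → ℝ => acceleration p (x 0))
      (MeasureTheory.volume : MeasureTheory.Measure (Fin 1 → ℝ)).toBoxAdditive.toSMul

namespace Highway

variable (H : Highway)

/-- Kinematically feasible trajectories. -/
def kinematic : Set (ℝ → ℝ) :=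
  {p | IsTrajectory p ∧ ∀ t, deriv p t ∈ Icc 0 H.vMax ∧ acceleration p t ∈ Icc H.aMin H.aMax}

/-- Times at which the signal at location `L` is green: the union over `m = 0, 1, 2, …` of
`[m C, m C + G)`, where `C = G + R`. -/
def green : Set ℝ :=
  {t | ∃ m : ℕ, m * (H.G + H.R) ≤ t ∧ t < m * (H.G + H.R) + H.G}

/-- The earliest green time that is not before `t`. -/
def nextGreen (t : ℝ) : ℝ :=
  sInf {t' | t' ∈ H.green ∧ t ≤ t'}

/-- Kinematically feasible trajectories through the entry (location `0`) at time `t₀`, speed `v₀`. -/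
def entrySet (v₀ t₀ : ℝ) : Set (ℝ → ℝ) :=
  {p | p ∈ H.kinematic ∧ p t₀ = 0 ∧ deriv p t₀ = v₀}

/-- Kinematically feasible trajectories that reach `L` during a green phase. The arrival time
`inf {t | p t ≥ L}` is expressed by `IsGLB`, so that a trajectory that never reaches `L`
(infimum `+∞`) is excluded. -/
def exitSet : Set (ℝ → ℝ) :=
  {p | p ∈ H.kinematic ∧ ∃ t ∈ H.green, IsGLB {t' | H.L ≤ p t'} t}

/-- The safety constraint for times in `I`: the follower `q` does not exceed the leader `p`
delayed by `τ` and shifted down by `s`. -/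
def SafeOn (I : Set ℝ) (p q : ℝ → ℝ) : Prop :=
  ∀ t ∈ I, H.s ≤ p (t - H.τ) - q t

/-- Feasible trajectory vectors for the entry data `v`, `t`. -/
def feasibleSet {N : ℕ} (v t : Fin N → ℝ) : Set (Fin N → ℝ → ℝ) :=
  {p | (∀ n, p n ∈ H.entrySet (v n) (t n) ∩ H.exitSet) ∧
    ∀ m n : Fin N, (m : ℕ) + 1 = n → H.SafeOn univ (p m) (p n)}

/-- The entry separations are sufficient for safety: for every vehicle `n`, the vehicles up to `n`
can have arrived with their prescribed entry states on kinematically feasible trajectories that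
obey the safety constraint at all times up to the entry time of `n`. -/
def SafeArrival {N : ℕ} (v t : Fin N → ℝ) : Prop :=
  ∀ n : Fin N, ∃ p : Fin N → ℝ → ℝ,
    (∀ k ≤ n, p k ∈ H.entrySet (v k) (t k)) ∧
    ∀ j k : Fin N, (j : ℕ) + 1 = k → k ≤ n → H.SafeOn (Iic (t n)) (p j) (p k)

/-- The upper bound trajectory of a state point: full acceleration from rest through the state
point up to the speed limit. -/
def upperBound (x : StatePoint) (t : ℝ) : ℝ :=
  if t ≤ x.time - x.speed / H.aMax then x.loc - x.speed ^ 2 / (2 * H.aMax)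
  else if t ≤ x.time + (H.vMax - x.speed) / H.aMax then
    x.loc + x.speed * (t - x.time) + H.aMax / 2 * (t - x.time) ^ 2
  else x.loc + H.vMax * (t - x.time) - (H.vMax - x.speed) ^ 2 / (2 * H.aMax)

/-- The lower bound trajectory of a state point: full braking from the speed limit through the
state point down to rest. -/
def lowerBound (x : StatePoint) (t : ℝ) : ℝ :=
  if t ≤ x.time - (x.speed - H.vMax) / H.aMin then
    x.loc + H.vMax * (t - x.time) - (H.vMax - x.speed) ^ 2 / (2 * H.aMin)
  else if t ≤ x.time + -x.speed / H.aMin then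
    x.loc + x.speed * (t - x.time) + H.aMin / 2 * (t - x.time) ^ 2
  else x.loc - x.speed ^ 2 / (2 * H.aMin)

/-- The distance `D(p - q)`, the least value of `p - q` over the whole time axis. -/
def trajDist (p q : ℝ → ℝ) : EReal :=
  ⨅ t : ℝ, ((p t - q t : ℝ) : EReal)

/-- Proper entry boundary conditions. -/
def Proper {N : ℕ} (v t : Fin N → ℝ) : Prop :=
  (∀ n, v n ∈ Icc 0 H.vMax) ∧
  ∀ m n : Fin N, m < n →
    0 ≤ trajDist
      (H.upperBound ⟨((m : ℝ) - n) * H.s, v m, t m + ((n : ℝ) - m) * H.τ⟩)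
      (H.lowerBound ⟨0, v n, t n⟩)

end Highway

/-- A trajectory section over `[start, ∞)`; the values of `pos` before `start` are irrelevant. -/
structure TrajSection where
  start : ℝ
  pos : ℝ → ℝ

/-- The speed along a section (one-sided at its start). -/
def TrajSection.speed (p : TrajSection) (t : ℝ) : ℝ :=
  derivWithin p.pos (Ici p.start) t

/-- The quadratic function through location `x.loc` at time `x.time` with speed `x.speed` and
acceleration `a`. -/
def quadratic (x : StatePoint) (a t : ℝ) : ℝ :=
  a / 2 * (t - x.time) ^ 2 + x.speed * (t - x.time) + x.loc

namespace Highway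

variable (H : Highway)

/-- The shadow of a section: delayed by `τ`, shifted down by `s`. -/
def shadow (p : TrajSection) : TrajSection :=
  ⟨p.start + H.τ, fun t => p.pos (t - H.τ) - H.s⟩

/-- State at time `t` on the forward template from `x`: accelerate at rate `aUp` up to the speed
limit, then cruise. -/
def forwardTemplate (aUp : ℝ) (x : StatePoint) (t : ℝ) : StatePoint :=
  if t ≤ x.time + (H.vMax - x.speed) / aUp then
    ⟨quadratic x aUp t, x.speed + aUp * (t - x.time), t⟩
  else
    ⟨x.loc + (H.vMax ^ 2 - x.speed ^ 2) / (2 * aUp)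
      + H.vMax * (t - (x.time + (H.vMax - x.speed) / aUp)), H.vMax, t⟩

/-- The forward template from `x` can be left at time `tm` on a merging segment with acceleration
`aDown` that gets tangent to the bounding section `b` at time `tp`, and neither the template up to
`tm` nor the merging segment from `tm` to `tp` exceeds `b`. -/
structure IsForwardMerge (aDown aUp : ℝ) (x : StatePoint) (b : TrajSection) (tm tp : ℝ) :
    Prop where
  start_le : x.time ≤ tm
  le : tm ≤ tp
  bound_start_le : b.start ≤ tp
  template_le : ∀ t ∈ Icc x.time tm, b.start ≤ t → (H.forwardTemplate aUp x t).loc ≤ b.pos t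
  merge_le : ∀ t ∈ Icc tm tp, b.start ≤ t →
    quadratic (H.forwardTemplate aUp x tm) aDown t ≤ b.pos t
  touch : quadratic (H.forwardTemplate aUp x tm) aDown tp = b.pos tp
  tangent : (H.forwardTemplate aUp x tm).speed + aDown * (tp - tm) = b.speed tp

open Classical in
/-- Forward shooting process from the state point `x` below the optional bounding section:
follow the template, merge tangentially into the bound and follow it from there on; if there is no
such merging point and the template stays below the bound, keep the template; otherwise there is
no output. -/
def forwardShooting (aDown aUp : ℝ) (x : StatePoint) : Option TrajSection → Option TrajSection
  | none => some ⟨x.time, fun t => (H.forwardTemplate aUp x t).loc⟩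
  | some b =>
    if h : ∃ w : ℝ × ℝ, H.IsForwardMerge aDown aUp x b w.1 w.2 then
      some ⟨x.time, fun t =>
        if t < h.choose.1 then (H.forwardTemplate aUp x t).loc
        else if t < h.choose.2 then quadratic (H.forwardTemplate aUp x h.choose.1) aDown t
        else b.pos t⟩
    else if ∀ t, x.time ≤ t → b.start ≤ t → (H.forwardTemplate aUp x t).loc ≤ b.pos t then
      some ⟨x.time, fun t => (H.forwardTemplate aUp x t).loc⟩
    else none

end Highway

/-- State at time `t` on the backward template from `x`: going backwards in time, the speed drops
at rate `aUp` down to zero, before which the vehicle is at rest. -/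
def backwardTemplate (aUp : ℝ) (x : StatePoint) (t : ℝ) : StatePoint :=
  if t ≤ x.time - x.speed / aUp then ⟨x.loc - x.speed ^ 2 / (2 * aUp), 0, t⟩
  else ⟨quadratic x aUp t, x.speed + aUp * (t - x.time), t⟩

/-- Going backwards in time from `x`, the backward template can be left at time `tm` on a merging
segment with acceleration `aDown` that gets tangent to the section `p` at time `tp`, and neither
the template nor the merging segment exceeds `p`. -/
structure IsBackwardMerge (aDown aUp : ℝ) (x : StatePoint) (p : TrajSection) (tm tp : ℝ) :
    Prop where
  start_le : p.start ≤ tp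
  le : tp ≤ tm
  le_time : tm ≤ x.time
  template_le : ∀ t ∈ Icc tm x.time, (backwardTemplate aUp x t).loc ≤ p.pos t
  merge_le : ∀ t ∈ Icc tp tm, quadratic (backwardTemplate aUp x tm) aDown t ≤ p.pos t
  touch : quadratic (backwardTemplate aUp x tm) aDown tp = p.pos tp
  tangent : (backwardTemplate aUp x tm).speed + aDown * (tp - tm) = p.speed tp

namespace Highway

variable (H : Highway)

open Classical in
/-- Backward shooting process from the state point `x` into the section `p`. The output consists of
the start location of the backward section and the extended trajectory: `p` up to the tangency, the
merging segment, the backward template up to `x`, and from `x` on an auxiliary forward shooting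
below `p`. There is no output if the backward section cannot be merged into `p`, or if the
auxiliary forward shooting fails. -/
def backwardShooting (aDownF aUpF aDownB aUpB : ℝ) (x : StatePoint) (p : TrajSection) :
    Option (ℝ × TrajSection) :=
  if h : ∃ w : ℝ × ℝ, IsBackwardMerge aDownB aUpB x p w.1 w.2 then
    (H.forwardShooting aDownF aUpF x (some p)).map fun aux =>
      (p.pos h.choose.2,
        ⟨p.start, fun t =>
          if t < h.choose.2 then p.pos t
          else if t < h.choose.1 then quadratic (backwardTemplate aUpB x h.choose.1) aDownB t
          else if t < x.time then (backwardTemplate aUpB x t).loc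
          else aux.pos t⟩)
  else none

/-- The time at which a section reaches location `L`. -/
def passTime (p : TrajSection) : ℝ :=
  sInf {t | p.start ≤ t ∧ H.L ≤ p.pos t}

open Classical in
/-- The shooting heuristic for one vehicle with entry speed `v₀` and entry time `t₀`, below the
shadow `b` of the preceding vehicle (`none` for the lead vehicle): primary forward shooting, and,
if the result reaches `L` during red, backward shooting from location `L` at the start of the next
green phase, which has to meet the forward trajectory at a location no less than `0`. -/
def shootVehicle (aDownF aUpF aDownB aUpB v₀ t₀ : ℝ) (b : Option TrajSection) :
    Option TrajSection :=
  (H.forwardShooting aDownF aUpF ⟨0, v₀, t₀⟩ b).bind fun p =>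
    if H.passTime p ∈ H.green then some p
    else
      (H.backwardShooting aDownF aUpF aDownB aUpB
        ⟨H.L, p.speed (H.passTime p), H.nextGreen (H.passTime p)⟩ p).bind fun r =>
          if 0 ≤ r.1 then some r.2 else none

/-- The shooting heuristic for a list of vehicles (pairs of entry speed and entry time), below the
shadow `b` of the vehicle preceding them. -/
def shootList (aDownF aUpF aDownB aUpB : ℝ) :
    Option TrajSection → List (ℝ × ℝ) → Option (List TrajSection)
  | _, [] => some []
  | b, e :: es =>
    (H.shootVehicle aDownF aUpF aDownB aUpB e.1 e.2 b).bind fun p =>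
      (shootList aDownF aUpF aDownB aUpB (some (H.shadow p)) es).map fun P => p :: P

/-- The shooting heuristic with forward deceleration and acceleration rates `aDownF`, `aUpF` and
backward deceleration and acceleration rates `aDownB`, `aUpB`; `none` is the empty output. -/
def shootingHeuristic (aDownF aUpF aDownB aUpB : ℝ) {N : ℕ} (v t : Fin N → ℝ) :
    Option (List TrajSection) :=
  H.shootList aDownF aUpF aDownB aUpB none (List.ofFn fun n => (v n, t n))

end Highway

end

/-! Necessity of properness is a chain of comparisons. Adding up the safety constraints between
vehicles `m` and `n` puts `p n` below `p m`, delayed by `(n - m) τ` and lowered by `(n - m) s`. A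
feasible trajectory lies between the full-braking and full-acceleration curves through its entry
state, so the two extreme curves are ordered as well (`lowerBound_le_upperShadow_of_safe`).

Sufficiency rests on a maximality property of the shooting outputs, the field `ge` of `IsOutput`.
From the entry time on, the output dominates every curve that brakes at most at rate `aMin`, stays
below the template and the bound, and never passes `L - vMax² / (2 aMax)`. Where the output follows
the template or the bound this is immediate. On a merging parabola, the competitor minus the
parabola is convex and nonpositive at both ends. The backward template never lies below `L - vMax² /
(2 aMax)`. The competitors of interest are the full-braking curves of all later vehicles, moved to
the position of the current one (`lowerShadow`). Properness puts them below the template, induction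
puts them below the bound, and the length condition keeps them far enough from `L`. Hence the room
for all later vehicles survives each step.

This room is also what makes a step succeed. If full braking from the entry state stays below the
bound but the template crosses it, then some intermediate departure time gives a parabola tangent to
the bound, by a continuity argument (`exists_tangent_parabola`). The same argument, reversed in
time, yields the backward merge at the signal (`exists_isBackwardMerge`) and the part of a
trajectory before its entry time (`exists_entry`). Gluing that past to the shooting output gives
elements of the feasible set.

Safe arrival connects this with the heuristic, whose curves start only at the entry times. It
separates consecutive entry times by at least `τ`, so that each shadow is available when the next
vehicle enters. It also supplies the properness inequality at times before the entry of the
follower, while success of the heuristic supplies it afterwards. -/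

noncomputable section

open Filter Topology

/-! ### Motions and their comparison -/

/-- `p` has velocity `v`, and `v` is semidifferentiable with right derivative `a`. -/
structure Motion (p v a : ℝ → ℝ) : Prop where
  hasDerivAt : ∀ t, HasDerivAt p (v t) t
  right : ∀ t, HasDerivWithinAt v (a t) (Ici t) t
  left : ∀ t, DifferentiableWithinAt ℝ v (Iic t) t

namespace Motion

variable {p v a p₁ v₁ a₁ p₂ v₂ a₂ : ℝ → ℝ}

theorem continuous (h : Motion p v a) : Continuous p :=
  continuous_iff_continuousAt.2 fun t => (h.hasDerivAt t).continuousAt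

theorem continuous_velocity (h : Motion p v a) : Continuous v :=
  continuous_iff_continuousAt.2 fun t =>
    continuousAt_iff_continuous_left_right.2
      ⟨(h.left t).continuousWithinAt, (h.right t).continuousWithinAt⟩

theorem deriv_eq (h : Motion p v a) : deriv p = v :=
  funext fun t => (h.hasDerivAt t).deriv

theorem acceleration_eq (h : Motion p v a) : acceleration p = a :=
  funext fun t => by
    rw [acceleration, h.deriv_eq]
    exact (h.right t).derivWithin (uniqueDiffOn_Ici t t self_mem_Ici)

theorem sub (h₁ : Motion p₁ v₁ a₁) (h₂ : Motion p₂ v₂ a₂) :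
    Motion (fun t => p₁ t - p₂ t) (fun t => v₁ t - v₂ t) (fun t => a₁ t - a₂ t) :=
  ⟨fun t => (h₁.hasDerivAt t).sub (h₂.hasDerivAt t), fun t => (h₁.right t).sub (h₂.right t),
    fun t => (h₁.left t).sub (h₂.left t)⟩

theorem shift (h : Motion p v a) (τ d : ℝ) :
    Motion (fun t => p (t - τ) - d) (fun t => v (t - τ)) (fun t => a (t - τ)) where
  hasDerivAt t := ((h.hasDerivAt (t - τ)).comp_sub_const t τ).sub_const d
  right t := by
    have := (h.right (t - τ)).scomp t (h := fun t => t - τ) (h' := 1)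
      ((hasDerivWithinAt_id t _).sub_const τ) (s := Ici t)
      (fun x hx => by simpa using hx)
    simpa [Function.comp_def] using this
  left t := (h.left (t - τ)).comp t (f := fun t => t - τ) (s := Iic t)
    (by fun_prop) (fun x hx => by simpa using hx)

/-- Only a right derivative of the velocity is available, so the mean value inequality for right
derivatives replaces the usual monotonicity criterion. -/
theorem velocity_monotoneOn (h : Motion p v a) {s t : ℝ} (ha : ∀ x ∈ Ico s t, 0 ≤ a x) :
    MonotoneOn v (Icc s t) := by
  intro x hx y hy hxy
  exact image_le_of_deriv_right_le_deriv_boundary (f := fun _ => v x) (f' := fun _ => 0)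
    (a := x) (b := y) continuousOn_const (fun _ _ => hasDerivWithinAt_const _ _ _) le_rfl
    h.continuous_velocity.continuousOn (fun z _ => h.right z)
    (fun z hz => ha z ⟨hx.1.trans hz.1, hz.2.trans_le hy.2⟩) ⟨hxy, le_rfl⟩

theorem monotoneOn (h : Motion p v a) {s : Set ℝ} (hs : Convex ℝ s) (hv : ∀ x ∈ s, 0 ≤ v x) :
    MonotoneOn p s :=
  monotoneOn_of_deriv_nonneg hs h.continuous.continuousOn
    (fun x _ => (h.hasDerivAt x).differentiableAt.differentiableWithinAt)
    fun x hx => by rw [h.deriv_eq]; exact hv x (interior_subset hx)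

/-- Forward comparison of positions. -/
theorem le_of_velocity_le (h₁ : Motion p₁ v₁ a₁) (h₂ : Motion p₂ v₂ a₂) {s t : ℝ} (hst : s ≤ t)
    (hs : p₁ s ≤ p₂ s) (hv : ∀ x ∈ Icc s t, v₁ x ≤ v₂ x) : p₁ t ≤ p₂ t := by
  have := (h₂.sub h₁).monotoneOn (convex_Icc s t) (fun x hx => sub_nonneg.2 (hv x hx))
    (left_mem_Icc.2 hst) (right_mem_Icc.2 hst) hst
  simp only at this
  linarith

/-- Backward comparison of positions. -/
theorem le_of_le_velocity (h₁ : Motion p₁ v₁ a₁) (h₂ : Motion p₂ v₂ a₂) {s t : ℝ} (hst : s ≤ t)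
    (ht : p₁ t ≤ p₂ t) (hv : ∀ x ∈ Icc s t, v₂ x ≤ v₁ x) : p₁ s ≤ p₂ s := by
  have := (h₁.sub h₂).monotoneOn (convex_Icc s t) (fun x hx => sub_nonneg.2 (hv x hx))
    (left_mem_Icc.2 hst) (right_mem_Icc.2 hst) hst
  simp only at this
  linarith

theorem velocity_le (h₁ : Motion p₁ v₁ a₁) (h₂ : Motion p₂ v₂ a₂) {s t : ℝ} (hst : s ≤ t)
    (hs : v₁ s ≤ v₂ s) (ha : ∀ x ∈ Ico s t, a₁ x ≤ a₂ x) : v₁ t ≤ v₂ t := by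
  have := (h₂.sub h₁).velocity_monotoneOn (fun x hx => sub_nonneg.2 (ha x hx))
    (left_mem_Icc.2 hst) (right_mem_Icc.2 hst) hst
  simp only at this
  linarith

theorem le_velocity (h₁ : Motion p₁ v₁ a₁) (h₂ : Motion p₂ v₂ a₂) {s t : ℝ} (hst : s ≤ t)
    (ht : v₁ t ≤ v₂ t) (ha : ∀ x ∈ Ico s t, a₂ x ≤ a₁ x) : v₁ s ≤ v₂ s := by
  have := (h₁.sub h₂).velocity_monotoneOn (fun x hx => sub_nonneg.2 (ha x hx))
    (left_mem_Icc.2 hst) (right_mem_Icc.2 hst) hst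
  simp only at this
  linarith

/-- If `p₁ - p₂` is convex and nonpositive at both ends of an interval, it is nonpositive inside. -/
theorem le_of_acceleration_ge (h₁ : Motion p₁ v₁ a₁) (h₂ : Motion p₂ v₂ a₂) {s t : ℝ}
    (hs : p₁ s ≤ p₂ s) (ht : p₁ t ≤ p₂ t) (ha : ∀ x ∈ Ico s t, a₂ x ≤ a₁ x) {x : ℝ}
    (hx : x ∈ Icc s t) : p₁ x ≤ p₂ x := by
  have hm := (h₁.sub h₂).velocity_monotoneOn (fun x hx => sub_nonneg.2 (ha x hx))
  rcases le_total (v₁ x) (v₂ x) with h | h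
  · exact h₁.le_of_velocity_le h₂ hx.1 hs fun y hy => by
      have := hm ⟨hy.1, hy.2.trans hx.2⟩ hx hy.2
      simp only at this
      linarith
  · exact h₁.le_of_le_velocity h₂ hx.2 ht fun y hy => by
      have := hm hx ⟨hx.1.trans hy.1, hy.2⟩ hy.1
      simp only at this
      linarith

end Motion

/-! ### Piecewise motions and the trajectories they define -/

/-- A motion whose acceleration has finitely many discontinuities. -/
structure RegularMotion (p v a : ℝ → ℝ) : Prop extends Motion p v a where
  finite : {t | ¬ ContinuousAt a t}.Finite

/-- The function that agrees with `f` before `c` and with `g` from `c` on. -/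
def glue (c : ℝ) (f g : ℝ → ℝ) (t : ℝ) : ℝ := if t < c then f t else g t

section glue

variable {c t : ℝ} {f g : ℝ → ℝ}

theorem glue_of_lt (h : t < c) : glue c f g t = f t := if_pos h

theorem glue_of_ge (h : c ≤ t) : glue c f g t = g t := if_neg h.not_gt

theorem glue_of_le (hc : f c = g c) (h : t ≤ c) : glue c f g t = f t := by
  rcases h.lt_or_eq with h | rfl
  · exact glue_of_lt h
  · rw [glue_of_ge le_rfl, hc]

theorem glue_eventuallyEq_of_lt (h : t < c) : glue c f g =ᶠ[𝓝 t] f :=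
  mem_of_superset (Iio_mem_nhds h) fun _ hx => glue_of_lt hx

theorem glue_eventuallyEq_of_gt (h : c < t) : glue c f g =ᶠ[𝓝 t] g :=
  mem_of_superset (Ioi_mem_nhds h) fun _ hx => glue_of_ge (le_of_lt hx)

theorem glue_forall {P : ℝ → Prop} (h₁ : t < c → P (f t)) (h₂ : c ≤ t → P (g t)) :
    P (glue c f g t) := by
  rcases lt_or_ge t c with h | h
  · rw [glue_of_lt h]; exact h₁ h
  · rw [glue_of_ge h]; exact h₂ h

end glue

namespace RegularMotion

variable {p v a p₁ v₁ a₁ p₂ v₂ a₂ : ℝ → ℝ}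

/-- Matching position and velocity at the junction suffices: the acceleration may jump there, which
adds at most one discontinuity. The value at `c` is the right-hand one, in agreement with the
acceleration being a right derivative. -/
theorem glue {c : ℝ} (h₁ : RegularMotion p₁ v₁ a₁) (h₂ : RegularMotion p₂ v₂ a₂)
    (hp : p₁ c = p₂ c) (hv : v₁ c = v₂ c) :
    RegularMotion (glue c p₁ p₂) (glue c v₁ v₂) (glue c a₁ a₂) where
  hasDerivAt t := by
    rcases lt_trichotomy t c with h | rfl | h
    · rw [glue_of_lt h]
      exact (h₁.hasDerivAt t).congr_of_eventuallyEq (glue_eventuallyEq_of_lt h)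
    · have hl : HasDerivWithinAt (_root_.glue t p₁ p₂) (v₂ t) (Iic t) t := by
        rw [← hv]
        exact (h₁.hasDerivAt t).hasDerivWithinAt.congr (fun x hx => glue_of_le hp hx)
          (glue_of_le hp le_rfl)
      have hr : HasDerivWithinAt (_root_.glue t p₁ p₂) (v₂ t) (Ici t) t :=
        (h₂.hasDerivAt t).hasDerivWithinAt.congr (fun x hx => glue_of_ge hx) (glue_of_ge le_rfl)
      have := hl.union hr
      rw [Iic_union_Ici, hasDerivWithinAt_univ] at this
      rwa [glue_of_ge le_rfl]
    · rw [glue_of_ge h.le]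
      exact (h₂.hasDerivAt t).congr_of_eventuallyEq (glue_eventuallyEq_of_gt h)
  right t := by
    rcases lt_or_ge t c with h | h
    · rw [glue_of_lt h]
      exact (h₁.right t).congr_of_eventuallyEq
        ((glue_eventuallyEq_of_lt h).filter_mono nhdsWithin_le_nhds) (glue_of_lt h)
    · rw [glue_of_ge h]
      exact (h₂.right t).congr (fun x hx => glue_of_ge (h.trans hx)) (glue_of_ge h)
  left t := by
    rcases le_or_gt t c with h | h
    · exact (h₁.left t).congr (fun x hx => glue_of_le hv (hx.trans h)) (glue_of_le hv h)
    · exact (h₂.left t).congr_of_eventuallyEq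
        ((glue_eventuallyEq_of_gt h).filter_mono nhdsWithin_le_nhds) (glue_of_ge h.le)
  finite := by
    refine ((h₁.finite.union h₂.finite).union (finite_singleton c)).subset fun t ht => ?_
    rcases lt_trichotomy t c with h | rfl | h
    · exact Or.inl (Or.inl fun hc => ht (hc.congr (glue_eventuallyEq_of_lt h).symm))
    · exact Or.inr rfl
    · exact Or.inl (Or.inr fun hc => ht (hc.congr (glue_eventuallyEq_of_gt h).symm))

theorem shift (h : RegularMotion p v a) (τ d : ℝ) :
    RegularMotion (fun t => p (t - τ) - d) (fun t => v (t - τ)) (fun t => a (t - τ)) where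
  toMotion := h.toMotion.shift τ d
  finite := by
    refine (h.finite.image (· + τ)).subset fun t ht => ⟨t - τ, fun hc => ht ?_, by simp⟩
    exact hc.comp (f := fun t => t - τ) (by fun_prop)

theorem congr (h : RegularMotion p v a) {p' v' : ℝ → ℝ} (hp : ∀ t, p' t = p t)
    (hv : ∀ t, v' t = v t) : RegularMotion p' v' a := by
  rwa [funext hp, funext hv]

end RegularMotion

theorem regularMotion_quadratic (x : StatePoint) (a : ℝ) :
    RegularMotion (quadratic x a) (fun t => x.speed + a * (t - x.time)) (fun _ => a) where
  hasDerivAt t := by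
    have h : HasDerivAt (fun t : ℝ => t - x.time) 1 t := (hasDerivAt_id t).sub_const _
    have := (((h.pow 2).const_mul (a / 2)).add (h.const_mul x.speed)).add_const x.loc
    refine this.congr_deriv ?_
    simp
    ring
  right t := by
    have h : HasDerivAt (fun t : ℝ => t - x.time) 1 t := (hasDerivAt_id t).sub_const _
    simpa using ((h.const_mul a).const_add x.speed).hasDerivWithinAt
  left t := by fun_prop
  finite := by simp [continuousAt_const]

theorem IsTrajectory.motion {p : ℝ → ℝ} (h : IsTrajectory p) :
    Motion p (deriv p) (acceleration p) where
  hasDerivAt t := (h.differentiable t).hasDerivAt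
  right t := (h.semidifferentiable_right t).hasDerivWithinAt
  left t := h.semidifferentiable_left t

/-- Bounded acceleration makes the velocity Lipschitz, hence absolutely continuous. A bounded
function with finitely many discontinuities is Riemann integrable. -/
theorem RegularMotion.isTrajectory {p v a : ℝ → ℝ} (h : RegularMotion p v a) {m M : ℝ}
    (ha : ∀ t, a t ∈ Icc m M) : IsTrajectory p := by
  have hab : ∀ t, |a t| ≤ max |m| |M| := fun t => abs_le_max_abs_abs (ha t).1 (ha t).2
  refine ⟨fun t => (h.hasDerivAt t).differentiableAt, fun s t => ?_, ?_, ?_, fun I => ?_⟩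
  · rw [h.deriv_eq]
    have key : ∀ x y, x ≤ y → |v y - v x| ≤ max |m| |M| * (y - x) := fun x y hxy => by
      simpa using norm_image_sub_le_of_norm_deriv_right_le_segment
        h.continuous_velocity.continuousOn (fun z _ => h.right z) (fun z _ => hab z) y
        ⟨hxy, le_rfl⟩
    have hL : LipschitzOnWith (max |m| |M|).toNNReal v (uIcc s t) := by
      refine LipschitzOnWith.of_dist_le_mul fun x _ y _ => ?_
      rw [Real.coe_toNNReal _ (le_max_of_le_left (abs_nonneg m)), Real.dist_eq, Real.dist_eq]
      rcases le_total x y with hxy | hxy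
      · rw [abs_sub_comm, abs_sub_comm x, abs_of_nonneg (sub_nonneg.2 hxy)]
        exact key x y hxy
      · rw [abs_of_nonneg (sub_nonneg.2 hxy)]
        exact key y x hxy
    exact hL.absolutelyContinuousOnInterval
  · intro t
    rw [h.deriv_eq]
    exact (h.right t).differentiableWithinAt
  · intro t
    rw [h.deriv_eq]
    exact h.left t
  · rw [h.acceleration_eq]
    refine BoxIntegral.integrable_of_bounded_and_ae_continuous _ ⟨_, fun x _ => hab _⟩ _ ?_
    have h0 : MeasureTheory.volume {t | ¬ ContinuousAt a t} = 0 := h.finite.measure_zero _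
    have h1 := (MeasureTheory.volume_preserving_funUnique (Fin 1) ℝ).quasiMeasurePreserving.preimage_null h0
    refine MeasureTheory.measure_mono_null (fun x hx => ?_) h1
    intro hc
    exact hx (ContinuousAt.comp (g := a) (f := fun x : Fin 1 → ℝ => x 0) hc
      (continuous_apply 0).continuousAt)

/-! ### Existence of tangent parabolas -/

section tangency

variable {f g : ℝ → ℝ} {f' g' s u : ℝ}

theorem derivative_le_of_touch_left_end (hf : HasDerivAt f f' s) (hg : HasDerivAt g g' s)
    (hsu : s < u) (h : ∀ t ∈ Icc s u, f t ≤ g t) (hs : f s = g s) : f' ≤ g' := by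
  have hd : HasDerivWithinAt (fun t => g t - f t) (g' - f') (Ioi s) s :=
    (hg.sub hf).hasDerivWithinAt
  rw [hasDerivWithinAt_iff_tendsto_slope' self_notMem_Ioi] at hd
  refine sub_nonneg.1 (ge_of_tendsto hd ?_)
  filter_upwards [Ioo_mem_nhdsGT hsu] with t ht
  rw [slope_def_field, hs, sub_self, sub_zero]
  exact div_nonneg (sub_nonneg.2 (h t ⟨ht.1.le, ht.2.le⟩)) (sub_nonneg.2 ht.1.le)

theorem derivative_le_of_touch_right_end (hf : HasDerivAt f f' s) (hg : HasDerivAt g g' s)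
    (hus : u < s) (h : ∀ t ∈ Icc u s, f t ≤ g t) (hs : f s = g s) : g' ≤ f' := by
  have hd : HasDerivWithinAt (fun t => g t - f t) (g' - f') (Iio s) s :=
    (hg.sub hf).hasDerivWithinAt
  rw [hasDerivWithinAt_iff_tendsto_slope' self_notMem_Iio] at hd
  refine sub_nonpos.1 (le_of_tendsto hd ?_)
  filter_upwards [Ioo_mem_nhdsLT hus] with t ht
  rw [slope_def_field, hs, sub_self, sub_zero]
  exact div_nonpos_of_nonneg_of_nonpos (sub_nonneg.2 (h t ⟨ht.1.le, ht.2.le⟩))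
    (sub_nonpos.2 ht.2.le)

/-- If `f` starts strictly below `g` to first order, it stays below for a while. -/
theorem exists_le_right_of_lt (hf : HasDerivAt f f' s) (hg : HasDerivAt g g' s)
    (hle : f s ≤ g s) (hlt : f s < g s ∨ f' < g') :
    ∃ δ > 0, ∀ t ∈ Icc s (s + δ), f t ≤ g t := by
  have key : ∀ᶠ t in 𝓝[>] s, f t ≤ g t := by
    rcases hlt with h | h
    · filter_upwards [nhdsWithin_le_nhds
        (hf.continuousAt.eventually_lt hg.continuousAt h)] with t ht using ht.le
    · have hd : HasDerivWithinAt (fun t => g t - f t) (g' - f') (Ioi s) s :=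
        (hg.sub hf).hasDerivWithinAt
      rw [hasDerivWithinAt_iff_tendsto_slope' self_notMem_Ioi] at hd
      filter_upwards [hd.eventually (lt_mem_nhds (sub_pos.2 h)), self_mem_nhdsWithin] with t ht hst
      rw [slope_def_field, div_pos_iff_of_pos_right (sub_pos.2 hst)] at ht
      linarith
  obtain ⟨u, hu, h⟩ := (mem_nhdsGT_iff_exists_Ioc_subset).1 key
  refine ⟨u - s, sub_pos.2 hu, fun t ht => ?_⟩
  rcases ht.1.eq_or_lt with rfl | hst
  · exact hle
  · exact h ⟨hst, by linarith [ht.2]⟩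

end tangency

/-- The curve that leaves `T` (with derivative `T'`) tangentially at `m` on a parabola with second
derivative `A`. -/
def leaveAt (T T' : ℝ → ℝ) (A m t : ℝ) : ℝ :=
  T (min t m) + T' (min t m) * (t - min t m) + A / 2 * (t - min t m) ^ 2

theorem leaveAt_of_le {T T' : ℝ → ℝ} {A m t : ℝ} (h : t ≤ m) : leaveAt T T' A m t = T t := by
  simp [leaveAt, h]

theorem leaveAt_of_ge {T T' : ℝ → ℝ} {A m t : ℝ} (h : m ≤ t) :
    leaveAt T T' A m t = T m + T' m * (t - m) + A / 2 * (t - m) ^ 2 := by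
  simp [leaveAt, h]

theorem hasDerivAt_parabola (x v A m t : ℝ) :
    HasDerivAt (fun t => x + v * (t - m) + A / 2 * (t - m) ^ 2) (v + A * (t - m)) t := by
  have h : HasDerivAt (fun t : ℝ => t - m) 1 t := (hasDerivAt_id t).sub_const _
  refine (((h.const_mul v).const_add x).add ((h.pow 2).const_mul (A / 2))).congr_deriv ?_
  simp
  ring

/-- A curve `T` that starts below `b` and exceeds `b` at some time `t₁` can be left on a parabola
that gets tangent to `b` from below. -/
theorem exists_tangent_parabola {T T' b b' : ℝ → ℝ} {A t₀ t₁ u : ℝ}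
    (hT : ∀ t, HasDerivAt T (T' t) t) (hT' : Continuous T') (hb : ∀ t, HasDerivAt b (b' t) t)
    (h₀₁ : t₀ ≤ t₁) (h₁u : t₁ ≤ u)
    (h₀ : ∀ t ∈ Icc t₀ u, T t₀ + T' t₀ * (t - t₀) + A / 2 * (t - t₀) ^ 2 ≤ b t)
    (h₁ : b t₁ < T t₁)
    (hle : ∀ m ∈ Icc t₀ t₁, ∀ t, m ≤ t → T m + T' m * (t - m) + A / 2 * (t - m) ^ 2 ≤ T t)
    (hend : ∀ m ∈ Icc t₀ t₁, m < u → T m + T' m * (u - m) + A / 2 * (u - m) ^ 2 = b u →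
      T' m + A * (u - m) < b' u) :
    ∃ m p, t₀ ≤ m ∧ m ≤ p ∧ p ≤ u ∧ (∀ t ∈ Icc t₀ m, T t ≤ b t) ∧
      (∀ t ∈ Icc m p, T m + T' m * (t - m) + A / 2 * (t - m) ^ 2 ≤ b t) ∧
      T m + T' m * (p - m) + A / 2 * (p - m) ^ 2 = b p ∧ T' m + A * (p - m) = b' p := by
  have hTb₀ : T t₀ ≤ b t₀ := by simpa using h₀ t₀ ⟨le_rfl, h₀₁.trans h₁u⟩
  have h₀₁' : t₀ < t₁ := by
    rcases h₀₁.lt_or_eq with h | rfl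
    · exact h
    · exact absurd hTb₀ h₁.not_ge
  -- If the template is already tangent to `b` at its start, the merge is trivial, with `m = p =
  -- t₀`.
  by_cases htouch : T t₀ = b t₀ ∧ T' t₀ = b' t₀
  · refine ⟨t₀, t₀, le_rfl, le_rfl, h₀₁.trans h₁u, fun t ht => ?_, fun t ht => ?_, ?_, ?_⟩
    · rw [Icc_self, mem_singleton_iff] at ht
      rw [ht]; exact hTb₀
    · rw [Icc_self, mem_singleton_iff] at ht
      rw [ht]; simpa using hTb₀
    · simpa using htouch.1
    · simpa using htouch.2
  -- Otherwise `T` stays below `b` for a while. Only contacts after `t₀ + δ` then matter, and these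
  -- have room on their left for a one-sided derivative comparison.
  obtain ⟨δ, hδ, hδle⟩ : ∃ δ > 0, ∀ t ∈ Icc t₀ (t₀ + δ), T t ≤ b t := by
    refine exists_le_right_of_lt (hT t₀) (hb t₀) hTb₀ ?_
    by_contra! hcon
    have heq : T t₀ = b t₀ := le_antisymm hTb₀ hcon.1
    refine htouch ⟨heq, le_antisymm ?_ hcon.2⟩
    -- The parabola leaving at `t₀` is below `b` and has the same value and slope as `T` there, so
    -- contact at `t₀` forces `T' t₀ ≤ b' t₀`.
    have hpar := hasDerivAt_parabola (T t₀) (T' t₀) A t₀ t₀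
    simp only [sub_self, mul_zero, add_zero] at hpar
    exact derivative_le_of_touch_left_end hpar (hb t₀) (h₀₁'.trans_le h₁u) h₀ (by simpa using heq)
  have hδ₁ : t₀ + δ < t₁ := by
    by_contra! hcon
    exact (hδle t₁ ⟨h₀₁, hcon⟩).not_gt h₁
  set K := Icc (t₀ + δ) u
  have hTc : Continuous T := continuous_iff_continuousAt.2 fun t => (hT t).continuousAt
  have hbc : Continuous b := continuous_iff_continuousAt.2 fun t => (hb t).continuousAt
  have hF : Continuous ↿(fun m t => b t - leaveAt T T' A m t) := by
    simp only [Function.HasUncurry.uncurry, leaveAt, id]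
    fun_prop
  have hKne : K.Nonempty := nonempty_Icc.2 (hδ₁.le.trans h₁u)
  have hFm : ∀ m, ∃ t ∈ K, sInf ((fun t => b t - leaveAt T T' A m t) '' K) =
      b t - leaveAt T T' A m t ∧ ∀ y ∈ K, b t - leaveAt T T' A m t ≤ b y - leaveAt T T' A m y :=
    fun m => isCompact_Icc.exists_sInf_image_eq_and_le hKne
      (hF.comp (Continuous.prodMk continuous_const continuous_id)).continuousOn
  have hφ := isCompact_Icc.continuous_sInf (K := K) hF
  -- The least gap between `b` and the curve leaving `T` at `m` depends continuously on `m`. It is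
  -- nonnegative for `m = t₀` and negative for `m = t₁`, so it vanishes for some `m`, where the
  -- curve touches `b` from below.
  obtain ⟨m, hm, hm0⟩ : (0 : ℝ) ∈ (fun m => sInf ((fun t => b t - leaveAt T T' A m t) '' K)) ''
      Icc t₀ t₁ := by
    refine intermediate_value_Icc' h₀₁ hφ.continuousOn ⟨?_, ?_⟩
    · obtain ⟨t, ht, he, hmin⟩ := hFm t₁
      simp only [he]
      have := hmin t₁ ⟨hδ₁.le, h₁u⟩
      rw [leaveAt_of_le le_rfl] at this
      linarith
    · obtain ⟨t, ht, he, -⟩ := hFm t₀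
      simp only [he]
      have ht0 : t₀ ≤ t := by linarith [ht.1]
      rw [leaveAt_of_ge ht0]
      linarith [h₀ t ⟨ht0, ht.2⟩]
  obtain ⟨p, hp, he, hmin⟩ := hFm m
  simp only [he] at hm0
  have hpu : t₀ < p := by linarith [hp.1]
  have hcT : ∀ t, leaveAt T T' A m t ≤ T t := fun t => by
    rcases le_total t m with h | h
    · rw [leaveAt_of_le h]
    · rw [leaveAt_of_ge h]; exact hle m hm t h
  have hcb : ∀ t ∈ Icc t₀ u, leaveAt T T' A m t ≤ b t := fun t ht => by
    rcases le_total t (t₀ + δ) with h | h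
    · exact (hcT t).trans (hδle t ⟨ht.1, h⟩)
    · linarith [hmin t ⟨h, ht.2⟩]
  have htb : ∀ x ≤ u, ∀ t ∈ Icc t₀ (min m x), T t ≤ b t := fun x hx t ht => by
    rw [← leaveAt_of_le (T := T) (T' := T') (A := A) (ht.2.trans (min_le_left _ _))]
    exact hcb t ⟨ht.1, (ht.2.trans (min_le_right _ _)).trans hx⟩
  have hqb : ∀ t ∈ Icc m u, T m + T' m * (t - m) + A / 2 * (t - m) ^ 2 ≤ b t := fun t ht => by
    rw [← leaveAt_of_ge ht.1]
    exact hcb t ⟨hm.1.trans ht.1, ht.2⟩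
  -- The contact lies either on the parabola or still on `T`. In both cases, contact from below with
  -- room on both sides gives equal derivatives.
  rcases le_or_gt m p with hmp | hmp
  · have hq : T m + T' m * (p - m) + A / 2 * (p - m) ^ 2 = b p := by
      rw [← leaveAt_of_ge hmp]; linarith
    have hq' := hasDerivAt_parabola (T m) (T' m) A m p
    have hleft : b' p ≤ T' m + A * (p - m) := by
      rcases hmp.lt_or_eq with h | rfl
      · exact derivative_le_of_touch_right_end hq' (hb p) h
          (fun t ht => hqb t ⟨ht.1, ht.2.trans hp.2⟩) hq
      · have := derivative_le_of_touch_right_end (hT m) (hb m) hpu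
          (fun t ht => htb m hp.2 t (by simpa using ht)) (by simpa using hq)
        simpa using this
    -- Contact at the end of the window would give only one of the two slope inequalities, and
    -- `hend` contradicts that one.
    have hlt : p < u := by
      refine lt_of_le_of_ne hp.2 fun hpe => ?_
      subst hpe
      rcases hmp.lt_or_eq with h | rfl
      · exact (hend m hm h hq).not_ge hleft
      · have : t₁ = m := le_antisymm h₁u hm.2
        subst this
        simp only [sub_self] at hq
        linarith
    exact ⟨m, p, hm.1, hmp, hp.2, fun t ht => htb m (hmp.trans hp.2) t (by simpa using ht),
      fun t ht => hqb t ⟨ht.1, ht.2.trans hp.2⟩, hq,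
      le_antisymm (derivative_le_of_touch_left_end hq' (hb p) hlt
        (fun t ht => hqb t ⟨hmp.trans ht.1, ht.2⟩) hq) hleft⟩
  -- `T` itself touches `b` before being left, so the merge degenerates to departure and contact at
  -- `p`.
  · have hq : T p = b p := by
      rw [leaveAt_of_le hmp.le] at hm0
      linarith
    have hmu : m ≤ u := hm.2.trans h₁u
    have htb' : ∀ t ∈ Icc t₀ m, T t ≤ b t := fun t ht => htb m hmu t (by simpa using ht)
    refine ⟨p, p, hpu.le, le_rfl, hp.2, fun t ht => htb' t ⟨ht.1, ht.2.trans hmp.le⟩,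
      fun t ht => ?_, by simpa using hq, ?_⟩
    · rw [Icc_self, mem_singleton_iff] at ht
      rw [ht]; simpa using hq.le
    · simp only [sub_self, mul_zero, add_zero]
      exact le_antisymm
        (derivative_le_of_touch_left_end (hT p) (hb p) hmp
          (fun t ht => htb' t ⟨hpu.le.trans ht.1, ht.2⟩) hq)
        (derivative_le_of_touch_right_end (hT p) (hb p) hpu
          (fun t ht => htb' t ⟨ht.1, ht.2.trans hmp.le⟩) hq)

/-- The time-reversed form of `exists_tangent_parabola`. -/
theorem exists_tangent_parabola_backward {T T' b b' : ℝ → ℝ} {A t₀ t₁ u : ℝ}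
    (hT : ∀ t, HasDerivAt T (T' t) t) (hT' : Continuous T') (hb : ∀ t, HasDerivAt b (b' t) t)
    (h₀₁ : t₁ ≤ t₀) (h₁u : u ≤ t₁)
    (h₀ : ∀ t ∈ Icc u t₀, T t₀ + T' t₀ * (t - t₀) + A / 2 * (t - t₀) ^ 2 ≤ b t)
    (h₁ : b t₁ < T t₁)
    (hle : ∀ m ∈ Icc t₁ t₀, ∀ t, t ≤ m → T m + T' m * (t - m) + A / 2 * (t - m) ^ 2 ≤ T t)
    (hend : ∀ m ∈ Icc t₁ t₀, u < m → T m + T' m * (u - m) + A / 2 * (u - m) ^ 2 = b u →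
      b' u < T' m + A * (u - m)) :
    ∃ m p, m ≤ t₀ ∧ p ≤ m ∧ u ≤ p ∧ (∀ t ∈ Icc m t₀, T t ≤ b t) ∧
      (∀ t ∈ Icc p m, T m + T' m * (t - m) + A / 2 * (t - m) ^ 2 ≤ b t) ∧
      T m + T' m * (p - m) + A / 2 * (p - m) ^ 2 = b p ∧ T' m + A * (p - m) = b' p := by
  have hneg : ∀ {f f' : ℝ → ℝ}, (∀ t, HasDerivAt f (f' t) t) →
      ∀ t, HasDerivAt (fun t => f (-t)) (-f' (-t)) t := fun hf t => by
    simpa [Function.comp_def] using (hf (-t)).comp t (hasDerivAt_neg t)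
  obtain ⟨m, p, h1, h2, h3, h4, h5, h6, h7⟩ := exists_tangent_parabola (A := A) (t₀ := -t₀)
    (t₁ := -t₁) (u := -u) (hneg hT) (by fun_prop) (hneg hb) (neg_le_neg h₀₁) (neg_le_neg h₁u)
    (fun t ht => by
      have := h₀ (-t) ⟨by linarith [ht.2], by linarith [ht.1]⟩
      rw [neg_neg]
      linarith)
    (by simpa using h₁)
    (fun m hm t ht => by
      have := hle (-m) ⟨by linarith [hm.2], by linarith [hm.1]⟩ (-t) (by linarith)
      linarith)
    (fun m hm hmu he => by
      rw [neg_neg] at he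
      have := hend (-m) ⟨by linarith [hm.2], by linarith [hm.1]⟩ (by linarith) (by linarith)
      rw [neg_neg]
      linarith)
  refine ⟨-m, -p, by linarith, by linarith, by linarith, fun t ht => ?_, fun t ht => ?_, ?_, ?_⟩
  · simpa using h4 (-t) ⟨by linarith [ht.2], by linarith [ht.1]⟩
  · have := h5 (-t) ⟨by linarith [ht.2], by linarith [ht.1]⟩
    rw [neg_neg] at this
    linarith
  · linarith
  · linarith

/-! ### Templates and extreme curves as motions -/

namespace Highway

variable (H : Highway) (x : StatePoint)

@[simp]
theorem forwardTemplate_time (a t : ℝ) : (H.forwardTemplate a x t).time = t := by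
  unfold forwardTemplate; split_ifs <;> rfl

theorem forwardTemplate_speed (t : ℝ) :
    (H.forwardTemplate H.aMax x t).speed = min H.vMax (x.speed + H.aMax * (t - x.time)) := by
  have hA := H.aMax_pos
  have hc : t ≤ x.time + (H.vMax - x.speed) / H.aMax ↔
      x.speed + H.aMax * (t - x.time) ≤ H.vMax := by
    rw [← sub_le_iff_le_add', le_div_iff₀ hA]
    constructor <;> intro h <;> linarith
  unfold forwardTemplate
  split_ifs with h
  · rw [min_eq_right (hc.1 h)]
  · rw [min_eq_left (le_of_not_ge fun h' => h (hc.2 h'))]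

/-- The acceleration along the forward template. -/
def forwardAcceleration : ℝ → ℝ :=
  glue (x.time + (H.vMax - x.speed) / H.aMax) (fun _ => H.aMax) (fun _ => 0)

theorem forwardAcceleration_mem (t : ℝ) : H.forwardAcceleration x t ∈ Icc H.aMin H.aMax :=
  glue_forall (P := (· ∈ Icc H.aMin H.aMax))
    (fun _ => ⟨H.aMin_neg.le.trans H.aMax_pos.le, le_rfl⟩) (fun _ => ⟨H.aMin_neg.le, H.aMax_pos.le⟩)

theorem regularMotion_forwardTemplate :
    RegularMotion (fun t => (H.forwardTemplate H.aMax x t).loc)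
      (fun t => (H.forwardTemplate H.aMax x t).speed) (H.forwardAcceleration x) := by
  have hA := H.aMax_pos
  set c := x.time + (H.vMax - x.speed) / H.aMax with hc
  set l := x.loc + (H.vMax ^ 2 - x.speed ^ 2) / (2 * H.aMax) with hl
  have hp : quadratic x H.aMax c = quadratic ⟨l, H.vMax, c⟩ 0 c := by
    simp only [quadratic, hc, hl]
    field_simp
    ring
  have hv : x.speed + H.aMax * (c - x.time) = H.vMax + 0 * (c - c) := by
    simp only [hc]
    field_simp
    ring
  refine ((regularMotion_quadratic x H.aMax).glue
    (regularMotion_quadratic ⟨l, H.vMax, c⟩ 0) hp hv).congr (fun t => ?_) (fun t => ?_)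
  · unfold forwardTemplate
    split_ifs with h
    · rw [glue_of_le hp h]
    · rw [glue_of_ge (le_of_not_ge h)]
      simp only [quadratic]
      ring
  · unfold forwardTemplate
    split_ifs with h
    · rw [glue_of_le hv h]
    · rw [glue_of_ge (le_of_not_ge h)]
      simp

variable {x}

theorem forwardTemplate_loc_start (hx : x.speed ≤ H.vMax) :
    (H.forwardTemplate H.aMax x x.time).loc = x.loc := by
  have := div_nonneg (sub_nonneg.2 hx) H.aMax_pos.le
  rw [forwardTemplate, if_pos (by linarith)]
  simp [quadratic]

theorem forwardTemplate_speed_start (hx : x.speed ≤ H.vMax) :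
    (H.forwardTemplate H.aMax x x.time).speed = x.speed := by
  simp [forwardTemplate_speed, hx]

theorem forwardTemplate_speed_mem (hx : x.speed ∈ Icc 0 H.vMax) {t : ℝ} (ht : x.time ≤ t) :
    (H.forwardTemplate H.aMax x t).speed ∈ Icc 0 H.vMax := by
  rw [forwardTemplate_speed]
  have := mul_nonneg H.aMax_pos.le (sub_nonneg.2 ht)
  exact ⟨le_min H.vMax_pos.le (by linarith [hx.1]), min_le_left _ _⟩

theorem forwardTemplate_speed_pos (hx : 0 ≤ x.speed) {t : ℝ} (ht : x.time < t) :
    0 < (H.forwardTemplate H.aMax x t).speed := by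
  rw [forwardTemplate_speed]
  have := mul_pos H.aMax_pos (sub_pos.2 ht)
  exact lt_min H.vMax_pos (by linarith)

theorem forwardTemplate_unbounded (x : StatePoint) (M : ℝ) :
    ∃ t, x.time ≤ t ∧ M ≤ (H.forwardTemplate H.aMax x t).loc := by
  set c := x.time + (H.vMax - x.speed) / H.aMax with hc
  set l := x.loc + (H.vMax ^ 2 - x.speed ^ 2) / (2 * H.aMax) with hl
  have hV := H.vMax_pos
  -- The term `c + 1` places the time strictly inside the cruising branch.
  refine ⟨max x.time (max (c + 1) (c + (M - l) / H.vMax)), le_max_left _ _, ?_⟩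
  set t := max x.time (max (c + 1) (c + (M - l) / H.vMax))
  have h1 : c + 1 ≤ t := (le_max_left _ _).trans (le_max_right _ _)
  have h2 : c + (M - l) / H.vMax ≤ t := (le_max_right _ _).trans (le_max_right _ _)
  rw [forwardTemplate, if_neg (by linarith)]
  have : (M - l) / H.vMax ≤ t - c := by linarith
  rw [div_le_iff₀ hV] at this
  simp only
  linarith

variable (x)

@[simp]
theorem _root_.backwardTemplate_time (a t : ℝ) : (backwardTemplate a x t).time = t := by
  unfold backwardTemplate; split_ifs <;> rfl

theorem backwardTemplate_speed (t : ℝ) :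
    (backwardTemplate H.aMax x t).speed = max 0 (x.speed + H.aMax * (t - x.time)) := by
  have hA := H.aMax_pos
  have hc : t ≤ x.time - x.speed / H.aMax ↔ x.speed + H.aMax * (t - x.time) ≤ 0 := by
    rw [le_sub_comm, div_le_iff₀ hA]
    constructor <;> intro h <;> linarith
  unfold backwardTemplate
  split_ifs with h
  · rw [max_eq_left (hc.1 h)]
  · rw [max_eq_right (le_of_not_ge fun h' => h (hc.2 h'))]

/-- The acceleration along the backward template. -/
def backwardAcceleration : ℝ → ℝ :=
  glue (x.time - x.speed / H.aMax) (fun _ => 0) (fun _ => H.aMax)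

theorem backwardAcceleration_mem (t : ℝ) : H.backwardAcceleration x t ∈ Icc H.aMin H.aMax :=
  glue_forall (P := (· ∈ Icc H.aMin H.aMax))
    (fun _ => ⟨H.aMin_neg.le, H.aMax_pos.le⟩) (fun _ => ⟨H.aMin_neg.le.trans H.aMax_pos.le, le_rfl⟩)

theorem regularMotion_backwardTemplate :
    RegularMotion (fun t => (backwardTemplate H.aMax x t).loc)
      (fun t => (backwardTemplate H.aMax x t).speed) (H.backwardAcceleration x) := by
  have hA := H.aMax_pos
  set c := x.time - x.speed / H.aMax with hc
  set l := x.loc - x.speed ^ 2 / (2 * H.aMax) with hl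
  have hp : quadratic ⟨l, 0, c⟩ 0 c = quadratic x H.aMax c := by
    simp only [quadratic, hc, hl]
    field_simp
    ring
  have hv : 0 + 0 * (c - c) = x.speed + H.aMax * (c - x.time) := by
    simp only [hc]
    field_simp
    ring
  refine ((regularMotion_quadratic ⟨l, 0, c⟩ 0).glue
    (regularMotion_quadratic x H.aMax) hp hv).congr (fun t => ?_) (fun t => ?_)
  · unfold backwardTemplate
    split_ifs with h
    · rw [glue_of_le hp h]
      simp [quadratic, hl]
    · rw [glue_of_ge (le_of_not_ge h)]
  · unfold backwardTemplate
    split_ifs with h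
    · rw [glue_of_le hv h]
      simp
    · rw [glue_of_ge (le_of_not_ge h)]

variable {x}

theorem backwardTemplate_speed_end (hx : 0 ≤ x.speed) :
    (backwardTemplate H.aMax x x.time).speed = x.speed := by
  simp [backwardTemplate_speed, hx]

theorem backwardTemplate_loc_end (hx : 0 ≤ x.speed) :
    (backwardTemplate H.aMax x x.time).loc = x.loc := by
  have hA := H.aMax_pos
  unfold backwardTemplate
  split_ifs with h
  · have : x.speed / H.aMax ≤ 0 := by linarith
    rw [div_le_iff₀ hA] at this
    have : x.speed = 0 := by linarith
    simp [this]
  · simp [quadratic]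

theorem backwardTemplate_speed_mem (hx : x.speed ∈ Icc 0 H.vMax) {t : ℝ} (ht : t ≤ x.time) :
    (backwardTemplate H.aMax x t).speed ∈ Icc 0 H.vMax := by
  rw [backwardTemplate_speed]
  have := mul_nonneg H.aMax_pos.le (sub_nonneg.2 ht)
  exact ⟨le_max_left _ _, max_le H.vMax_pos.le (by linarith [hx.2])⟩

/-- Measured from the location of rest, the position on the moving branch is the squared speed
divided by `2 aMax`. -/
theorem le_backwardTemplate_loc (t : ℝ) :
    x.loc - x.speed ^ 2 / (2 * H.aMax) ≤ (backwardTemplate H.aMax x t).loc := by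
  have hA := H.aMax_pos
  unfold backwardTemplate
  split_ifs with h
  · exact le_rfl
  · have : quadratic x H.aMax t - (x.loc - x.speed ^ 2 / (2 * H.aMax)) =
        (x.speed + H.aMax * (t - x.time)) ^ 2 / (2 * H.aMax) := by
      simp only [quadratic]
      field_simp
      ring
    have : 0 ≤ (x.speed + H.aMax * (t - x.time)) ^ 2 / (2 * H.aMax) := by positivity
    simp only
    linarith

theorem upperBound_eq_forwardTemplate (hx : x.speed ∈ Icc 0 H.vMax) {t : ℝ} (ht : x.time ≤ t) :
    H.upperBound x t = (H.forwardTemplate H.aMax x t).loc := by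
  have hA := H.aMax_pos
  have h0 := div_nonneg hx.1 hA.le
  unfold upperBound forwardTemplate
  by_cases h1 : t ≤ x.time - x.speed / H.aMax
  · have ht' : t = x.time := by linarith
    have : x.speed / H.aMax = 0 := by linarith
    have hs : x.speed = 0 := by
      rcases div_eq_zero_iff.1 this with h | h
      · exact h
      · exact absurd h hA.ne'
    have h2 := div_nonneg (sub_nonneg.2 hx.2) hA.le
    rw [if_pos h1, if_pos (by linarith)]
    simp [hs, ht', quadratic]
  · rw [if_neg h1]
    split_ifs with h2
    · simp only [quadratic]; ring
    · simp only
      field_simp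
      ring

theorem upperBound_eq_backwardTemplate (hx : x.speed ∈ Icc 0 H.vMax) {t : ℝ} (ht : t ≤ x.time) :
    H.upperBound x t = (backwardTemplate H.aMax x t).loc := by
  have h2 := div_nonneg (sub_nonneg.2 hx.2) H.aMax_pos.le
  unfold upperBound backwardTemplate
  split_ifs with h1 h3
  · rfl
  · simp only [quadratic]; ring
  · linarith

variable (x)

/-- The speed along the lower bound trajectory. -/
def lowerSpeed (t : ℝ) : ℝ := max 0 (min H.vMax (x.speed + H.aMin * (t - x.time)))

/-- The acceleration along the lower bound trajectory. -/
def lowerAcceleration : ℝ → ℝ :=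
  glue (x.time - (x.speed - H.vMax) / H.aMin) (fun _ => 0)
    (glue (x.time + -x.speed / H.aMin) (fun _ => H.aMin) (fun _ => 0))

theorem lowerAcceleration_mem (t : ℝ) : H.lowerAcceleration x t ∈ Icc H.aMin 0 :=
  glue_forall (P := (· ∈ Icc H.aMin 0)) (fun _ => ⟨H.aMin_neg.le, le_rfl⟩)
    fun _ => glue_forall (P := (· ∈ Icc H.aMin 0)) (fun _ => ⟨le_rfl, H.aMin_neg.le⟩)
      fun _ => ⟨H.aMin_neg.le, le_rfl⟩

theorem regularMotion_lowerBound :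
    RegularMotion (H.lowerBound x) (H.lowerSpeed x) (H.lowerAcceleration x) := by
  have hA := H.aMin_neg
  have hA' := hA.ne
  set c₁ := x.time - (x.speed - H.vMax) / H.aMin with hc₁
  set c₂ := x.time + -x.speed / H.aMin with hc₂
  set l₁ := x.loc - (H.vMax ^ 2 + x.speed ^ 2 - 2 * H.vMax * x.speed) / (2 * H.aMin) with hl₁
  set l₂ := x.loc - x.speed ^ 2 / (2 * H.aMin) with hl₂
  have hc : c₁ < c₂ := by
    have h : c₂ - c₁ = -H.vMax / H.aMin := by rw [hc₁, hc₂]; field_simp; ring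
    have : 0 < -H.vMax / H.aMin := div_pos_of_neg_of_neg (neg_lt_zero.2 H.vMax_pos) hA
    linarith
  have iff₁ : ∀ t, t ≤ c₁ ↔ H.vMax ≤ x.speed + H.aMin * (t - x.time) := fun t => by
    rw [hc₁, le_sub_comm, div_le_iff_of_neg hA]
    constructor <;> intro h <;> linarith
  have iff₂ : ∀ t, t ≤ c₂ ↔ 0 ≤ x.speed + H.aMin * (t - x.time) := fun t => by
    rw [hc₂, ← sub_le_iff_le_add', le_div_iff_of_neg hA]
    constructor <;> intro h <;> linarith
  have hp₂ : quadratic x H.aMin c₂ = quadratic ⟨l₂, 0, c₂⟩ 0 c₂ := by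
    simp only [quadratic, hc₂, hl₂]
    field_simp
    ring
  have hv₂ : x.speed + H.aMin * (c₂ - x.time) = 0 + 0 * (c₂ - c₂) := by
    simp only [hc₂]
    field_simp
    ring
  have hp₁ : quadratic ⟨l₁, H.vMax, x.time⟩ 0 c₁ =
      glue c₂ (quadratic x H.aMin) (quadratic ⟨l₂, 0, c₂⟩ 0) c₁ := by
    rw [glue_of_lt hc]
    simp only [quadratic, hc₁, hl₁]
    field_simp
    ring
  have hv₁ : H.vMax + 0 * (c₁ - x.time) = glue c₂ (fun t => x.speed + H.aMin * (t - x.time))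
      (fun t => 0 + 0 * (t - c₂)) c₁ := by
    rw [glue_of_lt hc]
    simp only [hc₁]
    field_simp
    ring
  refine ((regularMotion_quadratic ⟨l₁, H.vMax, x.time⟩ 0).glue
    ((regularMotion_quadratic x H.aMin).glue (regularMotion_quadratic ⟨l₂, 0, c₂⟩ 0) hp₂ hv₂)
    hp₁ hv₁).congr (fun t => ?_) (fun t => ?_)
  · unfold lowerBound
    split_ifs with h1 h2
    · rw [glue_of_le hp₁ h1]
      simp only [quadratic, hl₁]
      field_simp
      ring
    · rw [glue_of_ge (le_of_not_ge h1), glue_of_le hp₂ h2]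
      simp only [quadratic]
      ring
    · rw [glue_of_ge (le_of_not_ge h1), glue_of_ge (le_of_not_ge h2)]
      simp [quadratic, hl₂]
  · unfold lowerSpeed
    rcases le_or_gt t c₁ with h1 | h1
    · rw [glue_of_le hv₁ h1, min_eq_left ((iff₁ t).1 h1), max_eq_right H.vMax_pos.le]
      simp
    · rw [min_eq_right (le_of_not_ge fun h => h1.not_ge ((iff₁ t).2 h)), glue_of_ge h1.le]
      rcases le_or_gt t c₂ with h2 | h2
      · rw [glue_of_le hv₂ h2, max_eq_right ((iff₂ t).1 h2)]
      · rw [glue_of_ge h2.le, max_eq_left (le_of_not_ge fun h => h2.not_ge ((iff₂ t).2 h))]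
        simp

theorem lowerBound_le_stopLocation (t : ℝ) :
    H.lowerBound x t ≤ x.loc - x.speed ^ 2 / (2 * H.aMin) := by
  have hA := H.aMin_neg
  set c := x.time + -x.speed / H.aMin
  have hmono := (H.regularMotion_lowerBound x).monotoneOn convex_univ
    -- The curve is monotone and constant once at rest. The comparison time exceeds the stopping
    -- time strictly, so that the last branch applies.
    (fun t _ => le_max_left 0 _) (mem_univ t) (mem_univ (max t (c + 1))) (le_max_left _ _)
  refine hmono.trans_eq ?_
  have h1 : c + 1 ≤ max t (c + 1) := le_max_right _ _
  have h2 : x.time - (x.speed - H.vMax) / H.aMin ≤ c := by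
    have h : c - (x.time - (x.speed - H.vMax) / H.aMin) = -H.vMax / H.aMin := by
      have := hA.ne
      simp only [c]; field_simp; ring
    have : 0 < -H.vMax / H.aMin := div_pos_of_neg_of_neg (neg_lt_zero.2 H.vMax_pos) hA
    linarith
  rw [lowerBound, if_neg (by linarith), if_neg (by linarith)]

variable {x}

theorem lowerSpeed_self (hx : x.speed ∈ Icc 0 H.vMax) : H.lowerSpeed x x.time = x.speed := by
  simp [lowerSpeed, hx.1, hx.2]

theorem lowerBound_self (hx : x.speed ∈ Icc 0 H.vMax) : H.lowerBound x x.time = x.loc := by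
  have hA := H.aMin_neg
  have h1 : 0 ≤ (x.speed - H.vMax) / H.aMin :=
    div_nonneg_of_nonpos (sub_nonpos.2 hx.2) hA.le
  have h2 : 0 ≤ -x.speed / H.aMin := div_nonneg_of_nonpos (neg_nonpos.2 hx.1) hA.le
  unfold lowerBound
  split_ifs with h3 h4
  · have : (x.speed - H.vMax) / H.aMin = 0 := by linarith
    rcases div_eq_zero_iff.1 this with h | h
    · have : (H.vMax - x.speed) = 0 := by linarith
      simp [this]
    · exact absurd h hA.ne
  · simp
  · linarith

/-! ### Feasible motions lie between the extreme curves -/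

section comparison

variable {p v a : ℝ → ℝ}

theorem quadratic_le (h : Motion p v a) {t : ℝ} (ht : x.time ≤ t)
    (ha : ∀ y ∈ Icc x.time t, H.aMin ≤ a y) (hp : x.loc ≤ p x.time) (hv : x.speed ≤ v x.time) :
    quadratic x H.aMin t ≤ p t := by
  refine (regularMotion_quadratic x H.aMin).le_of_velocity_le h ht (by simpa [quadratic]) ?_
  intro y hy
  exact (regularMotion_quadratic x H.aMin).velocity_le h hy.1 (by simpa) fun z hz =>
    ha z ⟨hz.1, hz.2.le.trans hy.2⟩

theorem le_forwardTemplate (h : Motion p v a) (hx : x.speed ≤ H.vMax)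
    (hb : ∀ t, x.time ≤ t → v t ∈ Icc 0 H.vMax ∧ a t ∈ Icc H.aMin H.aMax)
    (hp : p x.time = x.loc) (hv : v x.time = x.speed) {t : ℝ} (ht : x.time ≤ t) :
    p t ≤ (H.forwardTemplate H.aMax x t).loc := by
  refine h.le_of_velocity_le (H.regularMotion_forwardTemplate x).toMotion ht
    (by rw [H.forwardTemplate_loc_start hx, hp]) fun y hy => ?_
  rw [forwardTemplate_speed]
  refine le_min (hb y hy.1).1.2 ?_
  exact h.velocity_le (regularMotion_quadratic x H.aMax).toMotion hy.1 (by simp [hv])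
    fun z hz => (hb z hz.1).2.2

theorem le_upperBound (h : Motion p v a) (hx : x.speed ∈ Icc 0 H.vMax)
    (hb : ∀ t, v t ∈ Icc 0 H.vMax ∧ a t ∈ Icc H.aMin H.aMax)
    (hp : p x.time = x.loc) (hv : v x.time = x.speed) (t : ℝ) : p t ≤ H.upperBound x t := by
  rcases le_total x.time t with ht | ht
  · rw [H.upperBound_eq_forwardTemplate hx ht]
    exact H.le_forwardTemplate h hx.2 (fun t _ => hb t) hp hv ht
  · rw [H.upperBound_eq_backwardTemplate hx ht]
    refine h.le_of_le_velocity (H.regularMotion_backwardTemplate x).toMotion ht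
      (by rw [H.backwardTemplate_loc_end hx.1, hp]) fun y hy => ?_
    rw [backwardTemplate_speed]
    refine max_le (hb y).1.1 ?_
    exact (regularMotion_quadratic x H.aMax).le_velocity h hy.2 (by simp [hv])
      fun z hz => (hb z).2.2

theorem lowerBound_le_of_time_le (h : Motion p v a) (hx : x.speed ∈ Icc 0 H.vMax)
    (hb : ∀ t, x.time ≤ t → v t ∈ Icc 0 H.vMax ∧ a t ∈ Icc H.aMin H.aMax)
    (hp : p x.time = x.loc) (hv : v x.time = x.speed) {t : ℝ} (ht : x.time ≤ t) :
    H.lowerBound x t ≤ p t := by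
  refine (H.regularMotion_lowerBound x).le_of_velocity_le h ht
    (by rw [H.lowerBound_self hx, hp]) fun y hy => ?_
  refine max_le (hb y hy.1).1.1 ((min_le_right _ _).trans ?_)
  exact (regularMotion_quadratic x H.aMin).velocity_le h hy.1 (by simp [hv])
    fun z hz => (hb z hz.1).2.1

theorem lowerBound_le (h : Motion p v a) (hx : x.speed ∈ Icc 0 H.vMax)
    (hb : ∀ t, v t ∈ Icc 0 H.vMax ∧ a t ∈ Icc H.aMin H.aMax)
    (hp : p x.time = x.loc) (hv : v x.time = x.speed) (t : ℝ) : H.lowerBound x t ≤ p t := by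
  rcases le_total x.time t with ht | ht
  · exact H.lowerBound_le_of_time_le h hx (fun t _ => hb t) hp hv ht
  · refine (H.regularMotion_lowerBound x).le_of_le_velocity h ht
      (by rw [H.lowerBound_self hx, hp]) fun y hy => ?_
    refine le_trans (le_min (hb y).1.2 ?_) (le_max_right _ _)
    exact h.le_velocity (regularMotion_quadratic x H.aMin).toMotion hy.2 (by simp [hv])
      fun z hz => (hb z).2.1

end comparison

theorem upperBound_shift (x : StatePoint) (d e t : ℝ) :
    H.upperBound ⟨x.loc + d, x.speed, x.time + e⟩ t = H.upperBound x (t - e) + d := by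
  have h1 : t ≤ x.time + e - x.speed / H.aMax ↔ t - e ≤ x.time - x.speed / H.aMax := by
    constructor <;> intro h <;> linarith
  have h2 : t ≤ x.time + e + (H.vMax - x.speed) / H.aMax ↔
      t - e ≤ x.time + (H.vMax - x.speed) / H.aMax := by
    constructor <;> intro h <;> linarith
  simp only [upperBound, h1, h2]
  split_ifs <;> ring

end Highway

theorem nonneg_trajDist_iff {p q : ℝ → ℝ} : 0 ≤ Highway.trajDist p q ↔ ∀ t, q t ≤ p t := by
  simp only [Highway.trajDist, le_iInf_iff, EReal.coe_nonneg, sub_nonneg]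

theorem quadratic_apply (x : StatePoint) (a t : ℝ) :
    quadratic x a t = x.loc + x.speed * (t - x.time) + a / 2 * (t - x.time) ^ 2 := by
  rw [quadratic]; ring

@[simp]
theorem quadratic_self (x : StatePoint) (a : ℝ) : quadratic x a x.time = x.loc := by
  simp [quadratic]

/-! ### Invariants of forward and backward shooting -/

namespace Highway

variable (H : Highway)

/-- A section with regular motion that is kinematically feasible from its start on, never stands
still downstream of `L`, and covers every location. -/
structure Admissible (p : TrajSection) : Prop where
  motion : RegularMotion p.pos (deriv p.pos) (acceleration p.pos)
  bounds : ∀ t, p.start ≤ t →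
    deriv p.pos t ∈ Icc 0 H.vMax ∧ acceleration p.pos t ∈ Icc H.aMin H.aMax
  speed_pos : ∀ t, p.start ≤ t → H.L ≤ p.pos t → 0 < deriv p.pos t
  unbounded : ∀ M, ∃ t, p.start ≤ t ∧ M ≤ p.pos t

variable {H}

theorem Admissible.mk' {p v a : ℝ → ℝ} {s : ℝ} (h : RegularMotion p v a)
    (hb : ∀ t, s ≤ t → v t ∈ Icc 0 H.vMax ∧ a t ∈ Icc H.aMin H.aMax)
    (hL : ∀ t, s ≤ t → H.L ≤ p t → 0 < v t) (hu : ∀ M, ∃ t, s ≤ t ∧ M ≤ p t) :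
    H.Admissible ⟨s, p⟩ := by
  obtain rfl := h.deriv_eq
  obtain rfl := h.acceleration_eq
  exact ⟨h, hb, hL, hu⟩

theorem Admissible.speed_eq {p : TrajSection} (h : H.Admissible p) {t : ℝ} (ht : p.start ≤ t) :
    p.speed t = deriv p.pos t :=
  (h.motion.hasDerivAt t).hasDerivWithinAt.derivWithin (uniqueDiffOn_Ici p.start t ht)

theorem Admissible.monotoneOn {p : TrajSection} (h : H.Admissible p) :
    MonotoneOn p.pos (Ici p.start) :=
  h.motion.monotoneOn (convex_Ici _) fun t ht => (h.bounds t ht).1.1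

theorem Admissible.shadow {p : TrajSection} (h : H.Admissible p) :
    H.Admissible (H.shadow p) :=
  Admissible.mk' (h.motion.shift H.τ H.s) (fun t ht => h.bounds _ (le_sub_iff_add_le.2 ht))
    (fun t ht hL => h.speed_pos _ (le_sub_iff_add_le.2 ht) (by linarith [H.s_pos])) fun M => by
      obtain ⟨t, ht, hM⟩ := h.unbounded (M + H.s)
      exact ⟨t + H.τ, by linarith, by rw [add_sub_cancel_right]; linarith⟩

variable (H)

/-- An admissible section from the state point `x` that stays below `bo` and above all motions that
brake at most at rate `aMin`, stay below the template and `bo`, and leave room for accelerating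
to the speed limit before `L`. -/
structure IsOutput (x : StatePoint) (bo : Option TrajSection) (p : TrajSection) : Prop where
  start_eq : p.start = x.time
  admissible : H.Admissible p
  loc_eq : p.pos x.time = x.loc
  speed_eq : deriv p.pos x.time = x.speed
  le_bound : ∀ b ∈ bo, ∀ t, x.time ≤ t → p.pos t ≤ b.pos t
  ge : ∀ f v a : ℝ → ℝ, Motion f v a → (∀ t, H.aMin ≤ a t) →
    (∀ t, x.time ≤ t → f t ≤ (H.forwardTemplate H.aMax x t).loc) →
    (∀ b ∈ bo, ∀ t, x.time ≤ t → f t ≤ b.pos t) →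
    (∀ t, f t ≤ H.L - H.vMax ^ 2 / (2 * H.aMax)) → ∀ t, x.time ≤ t → f t ≤ p.pos t

variable {H} {x : StatePoint} {bo : Option TrajSection} {p b : TrajSection}

theorem isOutput_forwardTemplate (hx : x.speed ∈ Icc 0 H.vMax)
    (hpos : x.loc < H.L ∨ 0 < x.speed)
    (hb : ∀ b ∈ bo, ∀ t, x.time ≤ t → (H.forwardTemplate H.aMax x t).loc ≤ b.pos t) :
    H.IsOutput x bo ⟨x.time, fun t => (H.forwardTemplate H.aMax x t).loc⟩ where
  start_eq := rfl
  admissible := by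
    refine Admissible.mk' (H.regularMotion_forwardTemplate x)
      (fun t ht => ⟨H.forwardTemplate_speed_mem hx ht, H.forwardAcceleration_mem x t⟩)
      (fun t ht hL => ?_) (H.forwardTemplate_unbounded x)
    rcases ht.eq_or_lt with rfl | ht
    · rw [H.forwardTemplate_loc_start hx.2] at hL
      rw [H.forwardTemplate_speed_start hx.2]
      exact hpos.resolve_left hL.not_gt
    · exact H.forwardTemplate_speed_pos hx.1 ht
  loc_eq := H.forwardTemplate_loc_start hx.2
  speed_eq := by
    simp only [(H.regularMotion_forwardTemplate x).deriv_eq, H.forwardTemplate_speed_start hx.2]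
  le_bound := hb
  ge _ _ _ _ _ hT _ _ := hT

/-- This holds for every merging pair, so the arbitrary choice made by the heuristic is harmless.
Speeds on the braking parabola lie between that of `b` at the tangency and that of the template at
departure, hence within the limits. -/
theorem isOutput_forwardMerge (hx : x.speed ∈ Icc 0 H.vMax)
    (hpos : x.loc < H.L ∨ 0 < x.speed) (hb : H.Admissible b) (hbx : b.start ≤ x.time) {tm tp : ℝ}
    (hm : H.IsForwardMerge H.aMin H.aMax x b tm tp) :
    H.IsOutput x (some b) ⟨x.time, glue tm (fun t => (H.forwardTemplate H.aMax x t).loc)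
      (glue tp (quadratic (H.forwardTemplate H.aMax x tm) H.aMin) b.pos)⟩ := by
  have hA := H.aMin_neg
  set y := H.forwardTemplate H.aMax x tm with hy
  have hyt : y.time = tm := H.forwardTemplate_time _ _ _
  set q := quadratic y H.aMin with hq
  set T := fun t => (H.forwardTemplate H.aMax x t).loc with hT
  have hTm := H.regularMotion_forwardTemplate x
  have hqm := regularMotion_quadratic y H.aMin
  have htouch : q tp = b.pos tp := hm.touch
  have htang : y.speed + H.aMin * (tp - y.time) = deriv b.pos tp := by
    rw [hyt, ← hb.speed_eq hm.bound_start_le]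
    exact hm.tangent
  have hqm0 : q tm = T tm := by
    rw [hq, ← hyt, quadratic_self, hyt]
  have hT0 : T tm = glue tp q b.pos tm := by
    rw [glue_of_le htouch hm.le, hqm0]
  have hv0 : (H.forwardTemplate H.aMax x tm).speed =
      glue tp (fun t => y.speed + H.aMin * (t - y.time)) (deriv b.pos) tm := by
    rw [glue_of_le htang hm.le, hyt]; simp [hy]
  have hreg := hTm.glue (hqm.glue hb.motion htouch htang) hT0 hv0
  have hqpos : ∀ t, t < tp → deriv b.pos tp ≤ y.speed + H.aMin * (t - y.time) := fun t ht => by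
    have := mul_nonneg_of_nonpos_of_nonpos hA.le (sub_nonpos.2 ht.le)
    rw [← htang]
    linarith
  have hymem := H.forwardTemplate_speed_mem hx hm.start_le
  have hstart : ∀ t, tp ≤ t → b.start ≤ t := fun t ht => hm.bound_start_le.trans ht
  have hqmono : MonotoneOn q (Icc tm tp) := by
    refine hqm.monotoneOn (convex_Icc _ _) fun t ht => ?_
    have := mul_nonneg_of_nonpos_of_nonpos hA.le (sub_nonpos.2 ht.2)
    have := (hb.bounds tp (hstart tp le_rfl)).1.1
    linarith
  -- If the parabola is already past `L`, so is `b` at the tangency. There `b` moves, and the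
  -- parabola is at least as fast before.
  have hpos_b : ∀ t, tm ≤ t → t ≤ tp → H.L ≤ q t → 0 < deriv b.pos tp := fun t h1 h2 hL => by
    refine hb.speed_pos tp (hstart tp le_rfl) (hL.trans ?_)
    rw [← htouch]
    exact hqmono ⟨h1, h2⟩ ⟨hm.le, le_rfl⟩ h2
  have hstart_eq : x.time ≤ tm := hm.start_le
  refine ⟨rfl, Admissible.mk' hreg (fun t ht => ?_) (fun t ht hL => ?_) (fun M => ?_), ?_, ?_,
    ?_, ?_⟩
  · rcases lt_or_ge t tm with h1 | h1
    · rw [glue_of_lt h1, glue_of_lt h1]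
      exact ⟨H.forwardTemplate_speed_mem hx ht, H.forwardAcceleration_mem x t⟩
    rw [glue_of_ge h1, glue_of_ge h1]
    rcases lt_or_ge t tp with h2 | h2
    · rw [glue_of_lt h2, glue_of_lt h2]
      refine ⟨⟨(hb.bounds tp (hstart tp le_rfl)).1.1.trans (hqpos t h2), ?_⟩,
        le_rfl, hA.le.trans H.aMax_pos.le⟩
      have := mul_nonpos_of_nonpos_of_nonneg hA.le (sub_nonneg.2 h1)
      rw [hyt]
      linarith [hymem.2]
    · rw [glue_of_ge h2, glue_of_ge h2]
      exact hb.bounds t (hstart t h2)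
  · rcases lt_or_ge t tm with h1 | h1
    · rw [glue_of_lt h1] at hL ⊢
      exact (isOutput_forwardTemplate (bo := none) hx hpos (by simp)).admissible.speed_pos t ht hL
        |>.trans_eq (by simp only [hTm.deriv_eq])
    rw [glue_of_ge h1] at hL ⊢
    rcases lt_or_ge t tp with h2 | h2
    · rw [glue_of_lt h2] at hL ⊢
      exact (hpos_b t h1 h2.le hL).trans_le (hqpos t h2)
    · rw [glue_of_ge h2] at hL ⊢
      exact hb.speed_pos t (hstart t h2) hL
  · obtain ⟨t, ht, hM⟩ := hb.unbounded M
    have h1 : tp ≤ max t tp := le_max_right _ _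
    refine ⟨max t tp, (hstart_eq.trans hm.le).trans h1, ?_⟩
    rw [glue_of_ge (hm.le.trans h1), glue_of_ge h1]
    exact hM.trans (hb.monotoneOn ht (ht.trans (le_max_left t tp)) (le_max_left _ _))
  · simp only
    rw [glue_of_le hT0 hstart_eq]
    exact H.forwardTemplate_loc_start hx.2
  · refine (congrFun hreg.deriv_eq _).trans
      ((glue_of_le (f := fun t => (H.forwardTemplate H.aMax x t).speed) hv0 hstart_eq).trans ?_)
    exact H.forwardTemplate_speed_start hx.2
  · rintro _ ⟨⟩ t ht
    simp only
    have hbt := hbx.trans ht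
    rcases lt_or_ge t tm with h1 | h1
    · rw [glue_of_lt h1]
      exact hm.template_le t ⟨ht, h1.le⟩ hbt
    rw [glue_of_ge h1]
    rcases lt_or_ge t tp with h2 | h2
    · rw [glue_of_lt h2]
      exact hm.merge_le t ⟨h1, h2.le⟩ hbt
    · rw [glue_of_ge h2]
  · intro f v a hf ha hfT hfb _ t ht
    simp only
    rcases lt_or_ge t tm with h1 | h1
    · rw [glue_of_lt h1]
      exact hfT t ht
    rw [glue_of_ge h1]
    rcases lt_or_ge t tp with h2 | h2
    · rw [glue_of_lt h2]
      -- The competitor brakes no harder than the parabola and is below it at both ends, so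
      -- convexity of the difference keeps it below in between.
      refine hf.le_of_acceleration_ge hqm.toMotion ((hfT tm hstart_eq).trans_eq hqm0.symm)
        ((hfb b rfl tp (hstart_eq.trans hm.le)).trans_eq htouch.symm) (fun z _ => ha z) ⟨h1, h2.le⟩
    · rw [glue_of_ge h2]
      exact hfb b rfl t ht

theorem forwardShooting_spec (hx : x.speed ∈ Icc 0 H.vMax)
    (hpos : x.loc < H.L ∨ 0 < x.speed) (hb : ∀ b ∈ bo, H.Admissible b ∧ b.start ≤ x.time)
    (h : H.forwardShooting H.aMin H.aMax x bo = some p) : H.IsOutput x bo p := by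
  cases bo with
  | none =>
    obtain rfl := Option.some.inj h
    exact isOutput_forwardTemplate hx hpos (by simp)
  | some b =>
    obtain ⟨hb, hbx⟩ := hb b rfl
    rw [forwardShooting] at h
    split_ifs at h with h1 h2
    · obtain rfl := Option.some.inj h
      exact isOutput_forwardMerge hx hpos hb hbx h1.choose_spec
    · obtain rfl := Option.some.inj h
      refine isOutput_forwardTemplate hx hpos ?_
      rintro _ ⟨⟩ t ht
      exact h2 t ht (hbx.trans ht)

/-- If the template crosses `b` although full braking from `x` does not, the continuity argument
produces a tangent merge; failure is therefore impossible. -/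
theorem forwardShooting_isSome (hx : x.speed ∈ Icc 0 H.vMax)
    (hb : ∀ b ∈ bo, H.Admissible b ∧ b.start ≤ x.time)
    (hq : ∀ b ∈ bo, ∀ t, x.time ≤ t → quadratic x H.aMin t ≤ b.pos t) :
    (H.forwardShooting H.aMin H.aMax x bo).isSome := by
  cases bo with
  | none => rfl
  | some b =>
    obtain ⟨hb, hbx⟩ := hb b rfl
    have hq := hq b rfl
    rw [forwardShooting]
    split_ifs with h1 h2
    · rfl
    · rfl
    exfalso
    push Not at h2
    obtain ⟨t₁, ht₁, -, hlt⟩ := h2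
    have hA := H.aMin_neg
    have hTm := H.regularMotion_forwardTemplate x
    -- `d` is the time needed to brake from `vMax` to rest. After `d + 1` more time units the
    -- parabola has negative speed, below that of `b`, which excludes contact at the end of the
    -- window.
    set d := H.vMax / -H.aMin with hd
    have hd0 : 0 < d := div_pos H.vMax_pos (neg_pos.2 hA)
    have hdA : H.aMin * d = -H.vMax := by rw [hd]; field_simp; simp [hA.ne]
    have key := exists_tangent_parabola (A := H.aMin) (u := t₁ + d + 1) hTm.hasDerivAt
      hTm.continuous_velocity hb.motion.hasDerivAt ht₁ (by linarith)
      (fun t ht => by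
        have := hq t ht.1
        rwa [quadratic_apply, ← H.forwardTemplate_loc_start hx.2,
          ← H.forwardTemplate_speed_start hx.2] at this)
      hlt
      (fun m hm t ht => by
        have := H.quadratic_le (x := H.forwardTemplate H.aMax x m) hTm.toMotion (t := t)
          (by simpa) (fun y _ => (H.forwardAcceleration_mem x y).1) (by simp) (by simp)
        rwa [quadratic_apply, forwardTemplate_time] at this)
      (fun m hm hmu _ => by
        have h1 := (H.forwardTemplate_speed_mem hx hm.1).2
        have h2 := (hb.bounds (t₁ + d + 1) (by linarith)).1.1
        have h3 : H.aMin * (t₁ + d + 1 - m) ≤ H.aMin * (d + 1) :=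
          mul_le_mul_of_nonpos_left (by linarith [hm.2]) hA.le
        linarith)
    obtain ⟨m, r, h3, h4, -, h5, h6, h7, h8⟩ := key
    refine h1 ⟨(m, r), h3, h4, (hbx.trans h3).trans h4, fun t ht _ => h5 t ht, fun t ht _ => ?_,
      ?_, ?_⟩
    · rw [quadratic_apply, forwardTemplate_time]
      exact h6 t ht
    · rw [quadratic_apply, forwardTemplate_time]
      exact h7
    · rw [hb.speed_eq ((hbx.trans h3).trans h4)]
      exact h8

/-- A positive final speed is essential: the resting part of the template then lies strictly
upstream of `x.loc`. -/
theorem backwardTemplate_speed_pos (hx : 0 < x.speed) {t : ℝ}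
    (h : x.loc ≤ (backwardTemplate H.aMax x t).loc) : 0 < (backwardTemplate H.aMax x t).speed := by
  have hA := H.aMax_pos
  unfold backwardTemplate at h ⊢
  split_ifs at h ⊢ with h1
  · have : 0 < x.speed ^ 2 / (2 * H.aMax) := by positivity
    simp only at h
    linarith
  · rw [not_le, sub_lt_comm, lt_div_iff₀ hA] at h1
    simp only
    linarith

/-- The window of the continuity argument ends at `p.start`. There the template lies beyond `p` by
more than the full braking distance `vMax² / (-2 aMin)`, so a parabola reaching `p` only at its
start would have speed above `vMax`. -/
theorem exists_isBackwardMerge (hx : x.speed ∈ Icc 0 H.vMax) (hp : H.Admissible p)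
    (hpx : p.start ≤ x.time) (h₀ : ∀ t ∈ Icc p.start x.time, quadratic x H.aMin t ≤ p.pos t)
    (hfar : p.pos p.start + H.vMax ^ 2 / (-2 * H.aMin) < x.loc - x.speed ^ 2 / (2 * H.aMax)) :
    ∃ w : ℝ × ℝ, IsBackwardMerge H.aMin H.aMax x p w.1 w.2 := by
  have hA := H.aMin_neg
  have hTm := H.regularMotion_backwardTemplate x
  have hge := fun t => H.le_backwardTemplate_loc (x := x) t
  have hD : 0 ≤ H.vMax ^ 2 / (-2 * H.aMin) := div_nonneg (sq_nonneg _) (by linarith)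
  have key := exists_tangent_parabola_backward (A := H.aMin) (u := p.start) hTm.hasDerivAt
    hTm.continuous_velocity hp.motion.hasDerivAt hpx le_rfl
    (fun t ht => by
      have := h₀ t ht
      rwa [quadratic_apply, ← H.backwardTemplate_loc_end hx.1,
        ← H.backwardTemplate_speed_end hx.1] at this)
    (by linarith [hge p.start])
    (fun m hm t ht => by
      have hqm := regularMotion_quadratic (backwardTemplate H.aMax x m) H.aMin
      have := hqm.le_of_le_velocity hTm.toMotion ht
        (by rw [quadratic_apply]; simp)
        (fun y hy => hTm.le_velocity hqm.toMotion hy.2 (by simp)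
          fun z _ => (H.backwardAcceleration_mem x z).1)
      rwa [quadratic_apply, backwardTemplate_time] at this)
    (fun m hm hmu he => by
      set w := (backwardTemplate H.aMax x m).speed
      have hw : 0 ≤ w := (H.backwardTemplate_speed_mem hx hm.2).1
      have hz : 0 ≤ w + H.aMin * (p.start - m) :=
        add_nonneg hw (mul_nonneg_of_nonpos_of_nonpos hA.le (by linarith))
      have hlt : H.vMax ^ 2 / (-2 * H.aMin) < (backwardTemplate H.aMax x m).loc - p.pos p.start := by
        linarith [hge m]
      rw [div_lt_iff₀ (by linarith)] at hlt
      -- Along the parabola, the squared speed at `p.start` equals `w²` plus `-2 aMin` times the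
      -- distance covered, hence exceeds `vMax²`.
      refine (hp.bounds p.start le_rfl).1.2.trans_lt (lt_of_pow_lt_pow_left₀ 2 hz ?_)
      nlinarith [sq_nonneg w])
  obtain ⟨m, r, h3, h4, h5, h6, h7, h8, h9⟩ := key
  refine ⟨(m, r), h5, h4, h3, h6, fun t ht => ?_, ?_, ?_⟩
  · rw [quadratic_apply, backwardTemplate_time]
    exact h7 t ht
  · rw [quadratic_apply, backwardTemplate_time]
    exact h8
  · rw [hp.speed_eq h5]
    exact h9

/-- Backward shooting only lowers `p`, so the bound persists. Competitors stay at or upstream of `L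
- vMax² / (2 aMax)`, so they lie below the backward template, which rests no further upstream, and
below the auxiliary section, which starts at `L`. Convexity handles the parabola. -/
theorem isOutput_backwardMerge {x₀ : StatePoint} {aux : TrajSection}
    (hx : x.speed ∈ Icc 0 H.vMax) (hpos : 0 < x.speed) (hxL : x.loc = H.L)
    (hp : H.IsOutput x₀ bo p) {tm tp : ℝ} (hm : IsBackwardMerge H.aMin H.aMax x p tm tp)
    (haux : H.IsOutput x (some p) aux) :
    H.IsOutput x₀ bo ⟨p.start, glue tp p.pos (glue tm
      (quadratic (backwardTemplate H.aMax x tm) H.aMin)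
      (glue x.time (fun t => (backwardTemplate H.aMax x t).loc) aux.pos))⟩ := by
  have hA := H.aMin_neg
  set y := backwardTemplate H.aMax x tm with hy
  have hyt : y.time = tm := backwardTemplate_time _ _ _
  set q := quadratic y H.aMin with hq
  set B := fun t => (backwardTemplate H.aMax x t).loc with hB
  have hBm := H.regularMotion_backwardTemplate x
  have hqm := regularMotion_quadratic y H.aMin
  have hpa := hp.admissible
  have hst : x₀.time ≤ tp := hp.start_eq ▸ hm.start_le
  have haux_st : aux.start = x.time := haux.start_eq
  have hB0 : B x.time = aux.pos x.time := by
    rw [haux.loc_eq]; exact H.backwardTemplate_loc_end hx.1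
  have hBv0 : (backwardTemplate H.aMax x x.time).speed = deriv aux.pos x.time := by
    rw [haux.speed_eq]; exact H.backwardTemplate_speed_end hx.1
  have hqB : q tm = B tm := by
    rw [hq, ← hyt, quadratic_self, hyt]
  have hq0 : q tm = glue x.time B aux.pos tm := by rw [glue_of_le hB0 hm.le_time, hqB]
  have hqv0 : y.speed + H.aMin * (tm - y.time) =
      glue x.time (fun t => (backwardTemplate H.aMax x t).speed) (deriv aux.pos) tm := by
    rw [glue_of_le hBv0 hm.le_time, hyt]; simp [hy]
  have htouch : q tp = p.pos tp := hm.touch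
  have htang : y.speed + H.aMin * (tp - y.time) = deriv p.pos tp := by
    rw [hyt, ← hpa.speed_eq hm.start_le]
    exact hm.tangent
  have hp0 : p.pos tp = glue tm q (glue x.time B aux.pos) tp := by
    rw [glue_of_le hq0 hm.le, htouch]
  have hpv0 : deriv p.pos tp = glue tm (fun t => y.speed + H.aMin * (t - y.time))
      (glue x.time (fun t => (backwardTemplate H.aMax x t).speed) (deriv aux.pos)) tp := by
    rw [glue_of_le hqv0 hm.le, htang]
  have hreg := hpa.motion.glue
    (hqm.glue (hBm.glue haux.admissible.motion hB0 hBv0) hq0 hqv0) hp0 hpv0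
  have hymem : y.speed ∈ Icc 0 H.vMax := H.backwardTemplate_speed_mem hx hm.le_time
  have hpbd := (hpa.bounds tp hm.start_le).1
  have hBL : ∀ t, t ≤ x.time → B t ≤ H.L := fun t ht => by
    have := hBm.monotoneOn (convex_Iic x.time)
      (fun s hs => (H.backwardTemplate_speed_mem hx hs).1) ht (mem_Iic.2 le_rfl) ht
    exact this.trans_eq ((H.backwardTemplate_loc_end hx.1).trans hxL)
  have hvq : ∀ t, t < tm → 0 < y.speed + H.aMin * (t - y.time) := fun t ht => by
    have := mul_pos_of_neg_of_neg hA (sub_neg.2 ht)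
    rw [hyt]
    linarith [hymem.1]
  have hauxL : ∀ t, x.time ≤ t → H.L ≤ aux.pos t := fun t ht => by
    rw [← hxL, ← haux.loc_eq]
    exact haux.admissible.monotoneOn (mem_Ici.2 haux_st.le) (mem_Ici.2 (haux_st.trans_le ht)) ht
  refine ⟨hp.start_eq, Admissible.mk' hreg (fun t ht => ?_) (fun t ht hL => ?_) (fun M => ?_),
    ?_, ?_, ?_, ?_⟩
  · rcases lt_or_ge t tp with h1 | h1
    · rw [glue_of_lt h1, glue_of_lt h1]
      exact hpa.bounds t ht
    rw [glue_of_ge h1, glue_of_ge h1]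
    rcases lt_or_ge t tm with h2 | h2
    · rw [glue_of_lt h2, glue_of_lt h2]
      refine ⟨⟨(hvq t h2).le, ?_⟩, le_rfl, hA.le.trans H.aMax_pos.le⟩
      have : H.aMin * (t - y.time) ≤ H.aMin * (tp - y.time) :=
        mul_le_mul_of_nonpos_left (by linarith) hA.le
      linarith [hpbd.2]
    rw [glue_of_ge h2, glue_of_ge h2]
    rcases lt_or_ge t x.time with h3 | h3
    · rw [glue_of_lt h3, glue_of_lt h3]
      exact ⟨H.backwardTemplate_speed_mem hx h3.le, H.backwardAcceleration_mem x t⟩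
    · rw [glue_of_ge h3, glue_of_ge h3]
      exact haux.admissible.bounds t (haux_st.trans_le h3)
  · rcases lt_or_ge t tp with h1 | h1
    · rw [glue_of_lt h1] at hL ⊢
      exact hpa.speed_pos t ht hL
    rw [glue_of_ge h1] at hL ⊢
    rcases lt_or_ge t tm with h2 | h2
    · rw [glue_of_lt h2]
      exact hvq t h2
    rw [glue_of_ge h2] at hL ⊢
    rcases lt_or_ge t x.time with h3 | h3
    · rw [glue_of_lt h3] at hL ⊢
      exact backwardTemplate_speed_pos hpos (hxL ▸ hL)
    · rw [glue_of_ge h3] at hL ⊢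
      exact haux.admissible.speed_pos t (haux_st.trans_le h3) hL
  · obtain ⟨t, ht, hM⟩ := haux.admissible.unbounded M
    rw [haux_st] at ht
    refine ⟨t, hm.start_le.trans ((hm.le.trans hm.le_time).trans ht), ?_⟩
    rwa [glue_of_ge ((hm.le.trans hm.le_time).trans ht), glue_of_ge (hm.le_time.trans ht),
      glue_of_ge ht]
  · simp only
    rw [glue_of_le hp0 hst, hp.loc_eq]
  · exact (congrFun hreg.deriv_eq _).trans ((glue_of_le hpv0 hst).trans hp.speed_eq)
  · intro b hb t ht
    refine le_trans ?_ (hp.le_bound b hb t ht)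
    simp only
    rcases lt_or_ge t tp with h1 | h1
    · rw [glue_of_lt h1]
    rw [glue_of_ge h1]
    rcases lt_or_ge t tm with h2 | h2
    · rw [glue_of_lt h2]
      exact hm.merge_le t ⟨h1, h2.le⟩
    rw [glue_of_ge h2]
    rcases lt_or_ge t x.time with h3 | h3
    · rw [glue_of_lt h3]
      exact hm.template_le t ⟨h2, h3.le⟩
    · rw [glue_of_ge h3]
      exact haux.le_bound p rfl t h3
  · intro f v a hf ha hfT hfb hfL t ht
    have hfp := hp.ge f v a hf ha hfT hfb hfL
    have hX : x.loc - x.speed ^ 2 / (2 * H.aMax) ≥ H.L - H.vMax ^ 2 / (2 * H.aMax) := by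
      rw [hxL]
      have := H.aMax_pos
      have := hx.1
      have := hx.2
      gcongr
    have hfB : ∀ t, f t ≤ B t := fun t => (hfL t).trans (hX.trans (H.le_backwardTemplate_loc t))
    simp only
    rcases lt_or_ge t tp with h1 | h1
    · rw [glue_of_lt h1]
      exact hfp t ht
    rw [glue_of_ge h1]
    rcases lt_or_ge t tm with h2 | h2
    · rw [glue_of_lt h2]
      exact hf.le_of_acceleration_ge hqm.toMotion ((hfp tp hst).trans_eq htouch.symm)
        ((hfB tm).trans_eq hqB.symm)
        (fun z _ => ha z) ⟨h1, h2.le⟩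
    rw [glue_of_ge h2]
    rcases lt_or_ge t x.time with h3 | h3
    · rw [glue_of_lt h3]
      exact hfB t
    · rw [glue_of_ge h3]
      refine (hfL t).trans (le_trans ?_ (hauxL t h3))
      have := H.aMax_pos
      have : 0 ≤ H.vMax ^ 2 / (2 * H.aMax) := by positivity
      linarith

theorem Admissible.passTime_spec (hp : H.Admissible p) (h0 : p.pos p.start < H.L) :
    p.start ≤ H.passTime p ∧ p.pos (H.passTime p) = H.L := by
  set S := {t | p.start ≤ t ∧ H.L ≤ p.pos t}
  have hcl : IsClosed S :=
    isClosed_Ici.inter (isClosed_Ici.preimage hp.motion.continuous)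
  have hbdd : BddBelow S := ⟨p.start, fun t ht => ht.1⟩
  have hmem : H.passTime p ∈ S := hcl.csInf_mem (hp.unbounded H.L) hbdd
  obtain ⟨t, ht, hL⟩ := intermediate_value_Icc hmem.1 hp.motion.continuous.continuousOn
    ⟨h0.le, hmem.2⟩
  have : t = H.passTime p := le_antisymm ht.2 (csInf_le hbdd ⟨ht.1, hL.ge⟩)
  exact ⟨hmem.1, this ▸ hL⟩

/-- For a red `t` the infimum is attained at the first cycle start not before `t`: a later green
time in a cycle begun before `t` would make `t` itself green. -/
theorem nextGreen_spec {t : ℝ} (ht : t ∉ H.green) : H.nextGreen t ∈ H.green ∧ t ≤ H.nextGreen t := by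
  have hC : 0 < H.G + H.R := add_pos_of_pos_of_nonneg H.G_pos H.R_nonneg
  have hex : ∃ m : ℕ, t ≤ m * (H.G + H.R) := by
    obtain ⟨m, hm⟩ := exists_nat_ge (t / (H.G + H.R))
    exact ⟨m, (div_le_iff₀ hC).1 hm⟩
  classical
  have hmg : (Nat.find hex : ℝ) * (H.G + H.R) ∈ H.green :=
    ⟨Nat.find hex, le_rfl, lt_add_of_pos_right _ H.G_pos⟩
  have hleast : IsLeast {t' | t' ∈ H.green ∧ t ≤ t'} (Nat.find hex * (H.G + H.R)) := by
    refine ⟨⟨hmg, Nat.find_spec hex⟩, ?_⟩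
    rintro t' ⟨⟨k, hk, hk'⟩, htt'⟩
    have htk : t ≤ k * (H.G + H.R) := by
      by_contra! hlt
      exact ht ⟨k, hlt.le, htt'.trans_lt hk'⟩
    refine le_trans ?_ hk
    gcongr
    exact Nat.find_min' hex htk
  have : H.nextGreen t = Nat.find hex * (H.G + H.R) := hleast.csInf_eq
  rw [this]
  exact ⟨hmg, Nat.find_spec hex⟩

end Highway

/-! ### The heuristic for a single vehicle -/

namespace Highway

variable {H : Highway} {v₀ t₀ : ℝ} {bo : Option TrajSection} {p : TrajSection}

theorem IsOutput.passTime_spec (hp : H.IsOutput ⟨0, v₀, t₀⟩ bo p) :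
    t₀ ≤ H.passTime p ∧ p.pos (H.passTime p) = H.L ∧ p.speed (H.passTime p) ∈ Ioc 0 H.vMax := by
  have hst : p.start = t₀ := hp.start_eq
  obtain ⟨h1, h2⟩ := hp.admissible.passTime_spec (by
    rw [hst]; exact (hp.loc_eq : p.pos t₀ = 0).trans_lt H.L_pos)
  rw [hp.admissible.speed_eq h1]
  exact ⟨hst ▸ h1, h2, hp.admissible.speed_pos _ h1 h2.ge, (hp.admissible.bounds _ h1).1.2⟩

/-- Braking at full rate from a delayed copy of a state of an admissible section stays below it. -/
theorem Admissible.quadratic_delayed_le (hp : H.Admissible p) {s g t : ℝ} (hs : p.start ≤ s)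
    (hsg : s ≤ g) (ht : g ≤ t) :
    quadratic ⟨p.pos s, p.speed s, g⟩ H.aMin t ≤ p.pos t := by
  have h := H.quadratic_le (x := ⟨p.pos s, p.speed s, s⟩) hp.motion.toMotion
    (t := t - (g - s)) (by simp only; linarith)
    (fun y hy => (hp.bounds y (hs.trans hy.1)).2.1) le_rfl (hp.speed_eq hs).le
  -- Undelayed braking stays below `p`; the delay compares it with a later, hence larger, value of
  -- `p`.
  have h' := hp.monotoneOn (a := t - (g - s)) (b := t) (mem_Ici.2 (by linarith))
    (mem_Ici.2 (by linarith)) (by linarith)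
  refine le_trans (le_of_eq ?_) (h.trans h')
  simp only [quadratic]
  ring

/-- Going back from time `s`, the braking parabola is below `p`, and delay only helps since `p` is
monotone. As the shifted time may precede `p.start`, it is cut off there; the parabola increases up
to `s`, so the cut only raises it. -/
theorem Admissible.quadratic_delayed_le_of_le (hp : H.Admissible p) {s g t : ℝ} (hs : p.start ≤ s)
    (hsg : s ≤ g) (ht : t ∈ Icc p.start g) :
    quadratic ⟨p.pos s, p.speed s, g⟩ H.aMin t ≤ p.pos t := by
  set r := max (t - (g - s)) p.start with hr
  have hA := H.aMin_neg
  have hsp := (hp.bounds s hs).1.1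
  rw [← hp.speed_eq hs] at hsp
  have hrs : r ≤ s := max_le (by linarith [ht.2]) hs
  have hrt : r ≤ t := max_le (by linarith) ht.1
  have hqm := regularMotion_quadratic ⟨p.pos s, p.speed s, s⟩ H.aMin
  have h1 : quadratic ⟨p.pos s, p.speed s, g⟩ H.aMin t =
      quadratic ⟨p.pos s, p.speed s, s⟩ H.aMin (t - (g - s)) := by
    simp only [quadratic]
    ring
  have h2 := hqm.monotoneOn (convex_Iic s) (fun y hy => add_nonneg hsp
    (mul_nonneg_of_nonpos_of_nonpos hA.le (sub_nonpos.2 hy)))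
    (mem_Iic.2 ((le_max_left _ p.start).trans hrs)) (mem_Iic.2 hrs) (le_max_left _ _)
  have h3 : quadratic ⟨p.pos s, p.speed s, s⟩ H.aMin r ≤ p.pos r := by
    refine hqm.le_of_le_velocity hp.motion.toMotion hrs
      (quadratic_self ⟨p.pos s, p.speed s, s⟩ H.aMin).le fun y hy => ?_
    refine hp.motion.le_velocity hqm.toMotion hy.2 (by simp [hp.speed_eq hs]) fun z hz => ?_
    exact (hp.bounds z ((le_max_right _ _).trans (hy.1.trans hz.1))).2.1
  exact h1.le.trans (h2.trans (h3.trans (hp.monotoneOn (mem_Ici.2 (le_max_right _ _)) ht.1 hrt)))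

theorem shootVehicle_spec (hv : v₀ ∈ Icc 0 H.vMax)
    (hb : ∀ b ∈ bo, H.Admissible b ∧ b.start ≤ t₀)
    (h : H.shootVehicle H.aMin H.aMax H.aMin H.aMax v₀ t₀ bo = some p) :
    H.IsOutput ⟨0, v₀, t₀⟩ bo p ∧ ∃ g ∈ H.green, t₀ ≤ g ∧ p.pos g = H.L := by
  rw [shootVehicle, Option.bind_eq_some_iff] at h
  obtain ⟨q, hq, h⟩ := h
  have hqo := forwardShooting_spec hv (Or.inl H.L_pos) hb hq
  obtain ⟨h1, h2, h3⟩ := hqo.passTime_spec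
  split_ifs at h with hg
  · obtain rfl := Option.some.inj h
    exact ⟨hqo, _, hg, h1, h2⟩
  obtain ⟨hgreen, hle⟩ := nextGreen_spec hg
  rw [Option.bind_eq_some_iff] at h
  obtain ⟨r, hr, h⟩ := h
  split_ifs at h
  obtain rfl := Option.some.inj h
  set g := H.nextGreen (H.passTime q)
  have hst : q.start = t₀ := hqo.start_eq
  rw [backwardShooting] at hr
  split_ifs at hr with hm
  rw [Option.map_eq_some_iff] at hr
  obtain ⟨aux, haux, rfl⟩ := hr
  have hx : q.speed (H.passTime q) ∈ Icc 0 H.vMax := Ioc_subset_Icc_self h3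
  have hauxo := forwardShooting_spec hx (Or.inr h3.1)
    (by rintro _ ⟨⟩; exact ⟨hqo.admissible, hst.trans_le (h1.trans hle)⟩) haux
  have hmc := hm.choose_spec
  refine ⟨isOutput_backwardMerge hx h3.1 rfl hqo hmc hauxo, g, hgreen, h1.trans hle, ?_⟩
  have h4 : hm.choose.1 ≤ g := hmc.le_time
  have h5 : hm.choose.2 ≤ g := hmc.le.trans h4
  simp only
  rw [if_neg h5.not_gt, if_neg h4.not_gt, if_neg (lt_irrefl _)]
  exact hauxo.loc_eq

/-- Both shootings at the signal start from a delayed state of the forward output, and braking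
parabolas through delayed states stay below it. The length hypothesis makes the backward template
overshoot the entry by more than a braking distance. -/
theorem shootVehicle_isSome (hv : v₀ ∈ Icc 0 H.vMax)
    (hb : ∀ b ∈ bo, H.Admissible b ∧ b.start ≤ t₀)
    (hq : ∀ b ∈ bo, ∀ t, t₀ ≤ t → quadratic ⟨0, v₀, t₀⟩ H.aMin t ≤ b.pos t)
    (hL : H.vMax ^ 2 / (-2 * H.aMin) < H.L - H.vMax ^ 2 / (2 * H.aMax)) :
    (H.shootVehicle H.aMin H.aMax H.aMin H.aMax v₀ t₀ bo).isSome := by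
  obtain ⟨q, hqs⟩ := Option.isSome_iff_exists.1
    (forwardShooting_isSome (x := ⟨0, v₀, t₀⟩) hv hb hq)
  have hqo := forwardShooting_spec hv (Or.inl H.L_pos) hb hqs
  obtain ⟨h1, h2, h3⟩ := hqo.passTime_spec
  rw [shootVehicle, hqs, Option.bind_some]
  split_ifs with hg
  · rfl
  obtain ⟨-, hle⟩ := nextGreen_spec hg
  set g := H.nextGreen (H.passTime q)
  have hst : q.start = t₀ := hqo.start_eq
  have hx : q.speed (H.passTime q) ∈ Icc 0 H.vMax := Ioc_subset_Icc_self h3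
  have h0 : q.pos q.start = 0 := by rw [hst]; exact hqo.loc_eq
  have hm : ∃ w : ℝ × ℝ, IsBackwardMerge H.aMin H.aMax
      ⟨H.L, q.speed (H.passTime q), g⟩ q w.1 w.2 := by
    refine exists_isBackwardMerge hx hqo.admissible (hst.trans_le (h1.trans hle)) (fun t ht => ?_) ?_
    · have := hqo.admissible.quadratic_delayed_le_of_le (hst.trans_le h1) hle ht
      rwa [h2] at this
    · rw [h0, zero_add]
      refine hL.trans_le (sub_le_sub_left ?_ _)
      have := H.aMax_pos
      have := hx.1
      have := hx.2
      simp only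
      gcongr
  obtain ⟨aux, haux⟩ := Option.isSome_iff_exists.1 (forwardShooting_isSome
    (x := ⟨H.L, q.speed (H.passTime q), g⟩) (bo := some q) hx
    (by rintro _ ⟨⟩; exact ⟨hqo.admissible, hst.trans_le (h1.trans hle)⟩)
    (by
      rintro _ ⟨⟩ t ht
      have := hqo.admissible.quadratic_delayed_le (hst.trans_le h1) hle ht
      rwa [h2] at this))
  rw [backwardShooting, dif_pos hm, haux, Option.map_some, Option.bind_some]
  rw [if_pos]
  · rfl
  · have hc := hm.choose_spec.start_le
    rw [← h0]
    exact hqo.admissible.monotoneOn (mem_Ici.2 le_rfl) hc hc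

end Highway

/-! ### Motion before the entry time -/

namespace Highway

variable {H : Highway}

/-- A state can be reached, below the optional bound `bo`, on a motion that is kinematically
feasible before, and above all motions that brake at most at rate `aMin` and stay below the
backward template and `bo`. -/
theorem exists_entry {x : StatePoint} {bo : Option (ℝ → ℝ)} (hx : x.speed ∈ Icc 0 H.vMax)
    (hb : ∀ b ∈ bo, ∀ s, H.Admissible ⟨s, b⟩)
    (hq : ∀ b ∈ bo, ∀ t, t ≤ x.time → quadratic x H.aMin t ≤ b t) :
    ∃ q v a, RegularMotion q v a ∧
      (∀ t, t < x.time → v t ∈ Icc 0 H.vMax ∧ a t ∈ Icc H.aMin H.aMax) ∧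
      q x.time = x.loc ∧ v x.time = x.speed ∧ (∀ b ∈ bo, ∀ t, t ≤ x.time → q t ≤ b t) ∧
      ∀ f vf af : ℝ → ℝ, Motion f vf af → (∀ t, H.aMin ≤ af t) →
        (∀ t, t ≤ x.time → f t ≤ (backwardTemplate H.aMax x t).loc) →
        (∀ b ∈ bo, ∀ t, t ≤ x.time → f t ≤ b t) → ∀ t, t ≤ x.time → f t ≤ q t := by
  have hA := H.aMin_neg
  have hBm := H.regularMotion_backwardTemplate x
  by_cases hle : ∀ b ∈ bo, ∀ t, t ≤ x.time → (backwardTemplate H.aMax x t).loc ≤ b t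
  · exact ⟨_, _, _, hBm, fun t ht => ⟨H.backwardTemplate_speed_mem hx ht.le,
      H.backwardAcceleration_mem x t⟩, H.backwardTemplate_loc_end hx.1,
      H.backwardTemplate_speed_end hx.1, hle, fun _ _ _ _ _ hf _ => hf⟩
  push Not at hle
  obtain ⟨b, rfl, t₁, ht₁, hlt⟩ := hle
  have hb := hb b rfl
  have hq := hq b rfl
  -- Going back `d + 1` time units along the braking parabola gives a speed above `vMax`, hence
  -- above that of `b`, as needed at the end of the window.
  set d := H.vMax / -H.aMin with hd
  have hd0 : 0 < d := div_pos H.vMax_pos (neg_pos.2 hA)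
  have hdA : H.aMin * d = -H.vMax := by rw [hd]; field_simp; simp [hA.ne]
  have hbm : RegularMotion b (deriv b) (acceleration b) := (hb 0).motion
  have hbb : ∀ t, deriv b t ∈ Icc 0 H.vMax ∧ acceleration b t ∈ Icc H.aMin H.aMax :=
    fun t => (hb t).bounds t le_rfl
  obtain ⟨tm, tp, h1, h2, -, h3, h4, h5, h6⟩ := exists_tangent_parabola_backward (A := H.aMin)
    (u := t₁ - d - 1) hBm.hasDerivAt hBm.continuous_velocity hbm.hasDerivAt ht₁ (by linarith)
    (fun t ht => by
      have := hq t ht.2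
      rwa [quadratic_apply, ← H.backwardTemplate_loc_end hx.1,
        ← H.backwardTemplate_speed_end hx.1] at this)
    hlt
    (fun m hm t ht => by
      have hqm := regularMotion_quadratic (backwardTemplate H.aMax x m) H.aMin
      have := hqm.le_of_le_velocity hBm.toMotion ht
        (by rw [quadratic_apply]; simp)
        (fun y hy => hBm.le_velocity hqm.toMotion hy.2 (by simp)
          fun z _ => (H.backwardAcceleration_mem x z).1)
      rwa [quadratic_apply, backwardTemplate_time] at this)
    (fun m hm hmu _ => by
      have h1 := (H.backwardTemplate_speed_mem hx hm.2).1
      have h2 := (hbb (t₁ - d - 1)).1.2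
      have h3 : H.aMin * -(d + 1) ≤ H.aMin * (t₁ - d - 1 - m) :=
        mul_le_mul_of_nonpos_left (by linarith [hm.1]) hA.le
      linarith)
  set y := backwardTemplate H.aMax x tm with hy
  have hyt : y.time = tm := backwardTemplate_time _ _ _
  have hymem : y.speed ∈ Icc 0 H.vMax := H.backwardTemplate_speed_mem hx h1
  have hqm := regularMotion_quadratic y H.aMin
  have hqB : quadratic y H.aMin tm = y.loc := by
    conv_lhs => rw [← hyt]
    exact quadratic_self y H.aMin
  have hvB : y.speed + H.aMin * (tm - y.time) = y.speed := by rw [hyt]; ring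
  have hqeq : ∀ t, quadratic y H.aMin t = y.loc + y.speed * (t - tm) + H.aMin / 2 * (t - tm) ^ 2 :=
    fun t => by rw [quadratic_apply, hyt]
  have htouch : b tp = quadratic y H.aMin tp := by rw [hqeq]; exact h5.symm
  have htang : deriv b tp = y.speed + H.aMin * (tp - y.time) := by rw [hyt]; exact h6.symm
  have hp0 : b tp = glue tm (quadratic y H.aMin) (fun t => (backwardTemplate H.aMax x t).loc) tp := by
    rw [glue_of_le hqB h2, htouch]
  have hv0 : deriv b tp = glue tm (fun t => y.speed + H.aMin * (t - y.time))
      (fun t => (backwardTemplate H.aMax x t).speed) tp := by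
    rw [glue_of_le hvB h2, htang]
  refine ⟨_, _, _, hbm.glue (hqm.glue hBm hqB hvB) hp0 hv0, fun t ht => ?_, ?_, ?_, ?_, ?_⟩
  · rcases lt_or_ge t tp with h7 | h7
    · rw [glue_of_lt h7, glue_of_lt h7]
      exact hbb t
    rw [glue_of_ge h7, glue_of_ge h7]
    rcases lt_or_ge t tm with h8 | h8
    · rw [glue_of_lt h8, glue_of_lt h8]
      refine ⟨⟨add_nonneg hymem.1 (mul_nonneg_of_nonpos_of_nonpos hA.le ?_), ?_⟩, le_rfl,
        hA.le.trans H.aMax_pos.le⟩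
      · rw [hyt]; linarith
      · have : H.aMin * (t - y.time) ≤ H.aMin * (tp - y.time) :=
          mul_le_mul_of_nonpos_left (by linarith) hA.le
        linarith [(hbb tp).1.2]
    · rw [glue_of_ge h8, glue_of_ge h8]
      exact ⟨H.backwardTemplate_speed_mem hx ht.le, H.backwardAcceleration_mem x t⟩
  · rw [glue_of_ge (h2.trans h1), glue_of_ge h1]
    exact H.backwardTemplate_loc_end hx.1
  · rw [glue_of_ge (h2.trans h1), glue_of_ge h1]
    exact H.backwardTemplate_speed_end hx.1
  · rintro _ ⟨⟩ t ht
    rcases lt_or_ge t tp with h7 | h7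
    · rw [glue_of_lt h7]
    rw [glue_of_ge h7]
    rcases lt_or_ge t tm with h8 | h8
    · rw [glue_of_lt h8, hqeq]
      exact h4 t ⟨h7, h8.le⟩
    · rw [glue_of_ge h8]
      exact h3 t ⟨h8, ht⟩
  · intro f vf af hf haf hfB hfb t ht
    have hfb := hfb b rfl
    rcases lt_or_ge t tp with h7 | h7
    · rw [glue_of_lt h7]
      exact hfb t ht
    rw [glue_of_ge h7]
    rcases lt_or_ge t tm with h8 | h8
    · rw [glue_of_lt h8]
      exact hf.le_of_acceleration_ge hqm.toMotion ((hfb tp (h2.trans h1)).trans_eq htouch)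
        ((hfB tm h1).trans_eq hqB.symm) (fun z _ => haf z) ⟨h7, h8.le⟩
    · rw [glue_of_ge h8]
      exact hfB t ht

theorem quadratic_le_lowerBound {x : StatePoint} (hx : x.speed ∈ Icc 0 H.vMax) (t : ℝ) :
    quadratic x H.aMin t ≤ H.lowerBound x t := by
  have hm := H.regularMotion_lowerBound x
  rcases le_total x.time t with ht | ht
  · exact H.quadratic_le hm.toMotion ht (fun y _ => (H.lowerAcceleration_mem x y).1)
      (H.lowerBound_self hx).ge (H.lowerSpeed_self hx).ge
  · have hqm := regularMotion_quadratic x H.aMin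
    refine hqm.le_of_le_velocity hm.toMotion ht (by rw [quadratic_self, H.lowerBound_self hx])
      fun y hy => ?_
    exact hm.le_velocity hqm.toMotion hy.2 (by simp [H.lowerSpeed_self hx])
      fun z _ => (H.lowerAcceleration_mem x z).1

/-! ### Room for later vehicles and construction of feasible trajectories -/

section vehicles

variable {N : ℕ} {v t : Fin N → ℝ}

variable (H v t) in
/-- The lower bound trajectory of vehicle `j`, advanced to the position of vehicle `n`. -/
def lowerShadow (n : ℕ) (j : Fin N) : ℝ → ℝ :=
  H.lowerBound ⟨((j : ℝ) - n) * H.s, v j, t j - ((j : ℝ) - n) * H.τ⟩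

variable (H v t) in
/-- The upper bound trajectory of vehicle `m`, delayed to the position of vehicle `n`. -/
def upperShadow (n : ℕ) (m : Fin N) : ℝ → ℝ :=
  H.upperBound ⟨((m : ℝ) - n) * H.s, v m, t m + ((n : ℝ) - m) * H.τ⟩

theorem lowerBound_shift (x : StatePoint) (d e t : ℝ) :
    H.lowerBound ⟨x.loc + d, x.speed, x.time + e⟩ t = H.lowerBound x (t - e) + d := by
  have h1 : t ≤ x.time + e - (x.speed - H.vMax) / H.aMin ↔
      t - e ≤ x.time - (x.speed - H.vMax) / H.aMin := by
    constructor <;> intro h <;> linarith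
  have h2 : t ≤ x.time + e + -x.speed / H.aMin ↔ t - e ≤ x.time + -x.speed / H.aMin := by
    constructor <;> intro h <;> linarith
  simp only [lowerBound, h1, h2]
  split_ifs <;> ring

theorem lowerShadow_succ (n : ℕ) (j : Fin N) (x : ℝ) :
    H.lowerShadow v t (n + 1) j x = H.lowerShadow v t n j (x - H.τ) - H.s := by
  rw [lowerShadow, lowerShadow, sub_eq_add_neg _ H.s, ← lowerBound_shift]
  congr 2 <;> push_cast <;> ring

theorem upperShadow_succ (n : ℕ) (m : Fin N) (x : ℝ) :
    H.upperShadow v t (n + 1) m x = H.upperShadow v t n m (x - H.τ) - H.s := by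
  rw [upperShadow, upperShadow, sub_eq_add_neg _ H.s, ← upperBound_shift]
  congr 2 <;> push_cast <;> ring

theorem lowerShadow_self (n : Fin N) : H.lowerShadow v t n n = H.lowerBound ⟨0, v n, t n⟩ := by
  simp [lowerShadow]

theorem upperShadow_self (n : Fin N) : H.upperShadow v t n n = H.upperBound ⟨0, v n, t n⟩ := by
  simp [upperShadow]

theorem proper_iff : H.Proper v t ↔ (∀ n, v n ∈ Icc 0 H.vMax) ∧ ∀ m n : Fin N, m < n →
    ∀ x, H.lowerBound ⟨0, v n, t n⟩ x ≤ H.upperShadow v t n m x := by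
  simp only [Proper, nonneg_trajDist_iff]
  rfl

/-- This is the properness inequality for `n` and `j`, with the delay and the spacing moved from the
leader's curve to the follower's. -/
theorem Proper.lowerShadow_le_upperBound (h : H.Proper v t) {n j : Fin N} (hnj : n < j) (x : ℝ) :
    H.lowerShadow v t n j x ≤ H.upperBound ⟨0, v n, t n⟩ x := by
  have h1 := (proper_iff.1 h).2 n j hnj (x + ((j : ℝ) - n) * H.τ)
  have h2 := H.upperBound_shift ⟨0, v n, t n⟩ (((n : ℝ) - j) * H.s) (((j : ℝ) - n) * H.τ)
    (x + ((j : ℝ) - n) * H.τ)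
  have h3 := H.lowerBound_shift ⟨0, v j, t j⟩ (((j : ℝ) - n) * H.s) (-(((j : ℝ) - n) * H.τ)) x
  simp only [zero_add, ← sub_eq_add_neg, sub_neg_eq_add, add_sub_cancel_right] at h2 h3
  rw [upperShadow, h2] at h1
  rw [lowerShadow, h3]
  linarith

/-- A full-braking curve stops within `vMax² / (-2 aMin)` of its state point, and the shift adds at
most `(N - 1) s`. -/
theorem lowerShadow_le_of_length
    (hL : H.vMax ^ 2 / (2 * H.aMax) + 2 * (H.vMax ^ 2 / (-2 * H.aMin)) + H.s * ((N : ℝ) - 1)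
      ≤ H.L) (hv : ∀ n, v n ∈ Icc 0 H.vMax) (n : ℕ) (j : Fin N) (x : ℝ) :
    H.lowerShadow v t n j x ≤ H.L - H.vMax ^ 2 / (2 * H.aMax) := by
  refine (H.lowerBound_le_stopLocation _ x).trans ?_
  have hA := H.aMin_neg
  have hA' : 0 < -2 * H.aMin := by linarith
  have h1 : v j ^ 2 / (-2 * H.aMin) ≤ H.vMax ^ 2 / (-2 * H.aMin) := by
    have := (hv j).1
    have := (hv j).2
    gcongr
  have h2 : v j ^ 2 / (-2 * H.aMin) = -(v j ^ 2 / (2 * H.aMin)) := by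
    rw [neg_mul, div_neg]
  have h3 : 0 ≤ H.vMax ^ 2 / (-2 * H.aMin) := by positivity
  have h4 : ((j : ℝ) - n) * H.s ≤ ((N : ℝ) - 1) * H.s := by
    refine mul_le_mul_of_nonneg_right ?_ H.s_pos.le
    have h5 : ((j : ℕ) : ℝ) + 1 ≤ N := by exact_mod_cast j.2
    have h6 : (0 : ℝ) ≤ n := n.cast_nonneg
    linarith
  simp only
  linarith

/-- One step of the induction: room for vehicle `n` makes the shooting succeed, and maximality of
its output hands the room on to all later vehicles. -/
theorem exists_shootVehicle
    (hL : H.vMax ^ 2 / (2 * H.aMax) + 2 * (H.vMax ^ 2 / (-2 * H.aMin)) + H.s * ((N : ℝ) - 1)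
      ≤ H.L) (hP : H.Proper v t) (n : Fin N) {bo : Option TrajSection}
    (hb : ∀ b ∈ bo, H.Admissible b ∧ b.start ≤ t n ∧
      ∀ j, n ≤ j → ∀ x, b.start ≤ x → H.lowerShadow v t n j x ≤ b.pos x) :
    ∃ p, H.shootVehicle H.aMin H.aMax H.aMin H.aMax (v n) (t n) bo = some p ∧
      H.IsOutput ⟨0, v n, t n⟩ bo p ∧ (∃ g ∈ H.green, t n ≤ g ∧ p.pos g = H.L) ∧
      ∀ j, n < j → ∀ x, t n ≤ x → H.lowerShadow v t n j x ≤ p.pos x := by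
  have hv := hP.1
  have hb' : ∀ b ∈ bo, H.Admissible b ∧ b.start ≤ t n := fun b h => ⟨(hb b h).1, (hb b h).2.1⟩
  -- The second braking distance in the length condition makes this inequality strict.
  have hroom : H.vMax ^ 2 / (-2 * H.aMin) < H.L - H.vMax ^ 2 / (2 * H.aMax) := by
    have hA' : 0 < -2 * H.aMin := by linarith [H.aMin_neg]
    have := H.vMax_pos
    have h3 : 0 < H.vMax ^ 2 / (-2 * H.aMin) := by positivity
    have h1 : (1 : ℝ) ≤ N := by exact_mod_cast n.pos
    have := mul_nonneg H.s_pos.le (sub_nonneg.2 h1)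
    linarith
  obtain ⟨p, hp⟩ := Option.isSome_iff_exists.1 (shootVehicle_isSome (hv n) hb'
    (fun b h x hx => by
      refine (quadratic_le_lowerBound (x := ⟨0, v n, t n⟩) (hv n) x).trans ?_
      rw [← lowerShadow_self]
      exact (hb b h).2.2 n le_rfl x ((hb b h).2.1.trans hx)) hroom)
  obtain ⟨h1, h2⟩ := shootVehicle_spec (hv n) hb' hp
  refine ⟨p, hp, h1, h2, fun j hj => h1.ge _ _ _ (H.regularMotion_lowerBound _).toMotion
    (fun x => (H.lowerAcceleration_mem _ x).1) (fun x hx => ?_) (fun b h x hx => ?_)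
    (lowerShadow_le_of_length hL hv n j)⟩
  · rw [← H.upperBound_eq_forwardTemplate (hv n) hx]
    exact hP.lowerShadow_le_upperBound hj x
  · exact (hb b h).2.2 j hj.le x ((hb b h).2.1.trans hx)

/-- A trajectory on the whole time axis is found for vehicle `n`, if the bound given by its
predecessor leaves room for it and all later vehicles. -/
theorem exists_trajectory
    (hL : H.vMax ^ 2 / (2 * H.aMax) + 2 * (H.vMax ^ 2 / (-2 * H.aMin)) + H.s * ((N : ℝ) - 1)
      ≤ H.L) (hP : H.Proper v t) (n : Fin N) {bo : Option (ℝ → ℝ)}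
    (hb : ∀ b ∈ bo, (∀ s, H.Admissible ⟨s, b⟩) ∧
      ∀ j, n ≤ j → ∀ x, H.lowerShadow v t n j x ≤ b x) :
    ∃ p, (∀ s, H.Admissible ⟨s, p⟩) ∧ p (t n) = 0 ∧ deriv p (t n) = v n ∧
      (∃ g ∈ H.green, p g = H.L) ∧ (∀ b ∈ bo, ∀ x, p x ≤ b x) ∧
      ∀ j, n < j → ∀ x, H.lowerShadow v t n j x ≤ p x := by
  have hv := hP.1
  obtain ⟨r, -, hr, ⟨g, hg, hng, hgL⟩, hrj⟩ := exists_shootVehicle hL hP n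
    -- The bound is defined at all times here and is restarted at `t n`, so no ordering of the entry
    -- times is needed.
    (bo := bo.map fun b => ⟨t n, b⟩) (by
      intro b' h
      obtain ⟨b, hbo, rfl⟩ := Option.map_eq_some_iff.1 h
      exact ⟨(hb b hbo).1 _, le_rfl, fun j hj x _ => (hb b hbo).2 j hj x⟩)
  obtain ⟨q, vq, aq, hq, hqb, hq0, hqv, hqle, hqj⟩ := exists_entry (x := ⟨0, v n, t n⟩) (bo := bo)
    (hv n) (fun b h => (hb b h).1) (fun b h x _ => by
      refine (quadratic_le_lowerBound (x := ⟨0, v n, t n⟩) (hv n) x).trans ?_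
      rw [← lowerShadow_self]
      exact (hb b h).2 n le_rfl x)
  have hst : r.start = t n := hr.start_eq
  have hp0 : q (t n) = r.pos (t n) := hq0.trans hr.loc_eq.symm
  have hv0 : vq (t n) = deriv r.pos (t n) := hqv.trans hr.speed_eq.symm
  have hreg := hq.glue hr.admissible.motion hp0 hv0
  have hqL : ∀ x, x < t n → q x < H.L := fun x hx => by
    refine lt_of_le_of_lt ?_ (hq0.trans_lt H.L_pos)
    refine hq.monotoneOn (convex_Iic (t n)) (fun y hy => ?_) hx.le (mem_Iic.2 le_rfl) hx.le
    rcases (mem_Iic.1 hy).lt_or_eq with h | rfl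
    · exact (hqb y h).1.1
    · exact (hv n).1.trans_eq hqv.symm
  refine ⟨glue (t n) q r.pos, fun s => Admissible.mk' hreg (fun x _ => ?_) (fun x _ h => ?_)
    (fun M => ?_), ?_, ?_, ⟨g, hg, ?_⟩, fun b h x => ?_, fun j hj x => ?_⟩
  · rcases lt_or_ge x (t n) with h | h
    · rw [glue_of_lt h, glue_of_lt h]; exact hqb x h
    · rw [glue_of_ge h, glue_of_ge h]; exact hr.admissible.bounds x (hst.trans_le h)
  · rcases lt_or_ge x (t n) with hx | hx
    · rw [glue_of_lt hx] at h
      exact absurd h (hqL x hx).not_ge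
    · rw [glue_of_ge hx] at h ⊢
      exact hr.admissible.speed_pos x (hst.trans_le hx) h
  · obtain ⟨x, hx, hM⟩ := hr.admissible.unbounded M
    have h1 : r.start ≤ max x s := hx.trans (le_max_left _ _)
    refine ⟨max x s, le_max_right _ _, ?_⟩
    rw [glue_of_ge (hst ▸ h1)]
    exact hM.trans (hr.admissible.monotoneOn hx h1 (le_max_left _ _))
  · rw [glue_of_ge le_rfl]; exact hr.loc_eq
  · rw [hreg.deriv_eq, glue_of_ge le_rfl]; exact hr.speed_eq
  · rwa [glue_of_ge hng]
  · rcases lt_or_ge x (t n) with hx | hx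
    · rw [glue_of_lt hx]; exact hqle b h x hx.le
    · rw [glue_of_ge hx]
      exact hr.le_bound ⟨t n, b⟩ (Option.map_eq_some_iff.2 ⟨b, h, rfl⟩) x hx
  · rcases lt_or_ge x (t n) with hx | hx
    · rw [glue_of_lt hx]
      refine hqj _ _ _ (H.regularMotion_lowerBound _).toMotion
        (fun x => (H.lowerAcceleration_mem _ x).1) (fun x hx => ?_)
        (fun b h x _ => (hb b h).2 j hj.le x) x hx.le
      rw [← H.upperBound_eq_backwardTemplate (hv n) hx]
      exact hP.lowerShadow_le_upperBound hj x
    · rw [glue_of_ge hx]; exact hrj j hj x hx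

/-- Trajectories are chosen one vehicle after another, each below the shadow of its predecessor; the
room for all later vehicles is part of the induction hypothesis. -/
theorem Proper.feasibleSet_nonempty
    (hL : H.vMax ^ 2 / (2 * H.aMax) + 2 * (H.vMax ^ 2 / (-2 * H.aMin)) + H.s * ((N : ℝ) - 1)
      ≤ H.L) (hP : H.Proper v t) : (H.feasibleSet v t).Nonempty := by
  have key : ∀ k ≤ N, ∃ p : Fin N → ℝ → ℝ, ∀ n : Fin N, (n : ℕ) < k →
      ((∀ s, H.Admissible ⟨s, p n⟩) ∧ p n (t n) = 0 ∧ deriv (p n) (t n) = v n ∧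
        (∃ g ∈ H.green, p n g = H.L) ∧ ∀ j, n < j → ∀ x, H.lowerShadow v t n j x ≤ p n x) ∧
      ∀ m : Fin N, (m : ℕ) + 1 = n → ∀ x, p n x ≤ p m (x - H.τ) - H.s := by
    intro k
    induction k with
    | zero => exact fun _ => ⟨fun _ _ => 0, fun n hn => absurd hn (Nat.not_lt_zero _)⟩
    | succ k ih =>
      intro hk
      obtain ⟨p, hp⟩ := ih (by omega)
      obtain ⟨bo, hbo, hbo'⟩ : ∃ bo : Option (ℝ → ℝ),
          (∀ b ∈ bo, (∀ s, H.Admissible ⟨s, b⟩) ∧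
            ∀ j : Fin N, k ≤ j → ∀ x, H.lowerShadow v t k j x ≤ b x) ∧
          ∀ m : Fin N, (m : ℕ) + 1 = k → (fun x => p m (x - H.τ) - H.s) ∈ bo := by
        cases k with
        | zero => exact ⟨none, by simp, fun m hm => absurd hm (by omega)⟩
        | succ k =>
          obtain ⟨h1, -⟩ := hp ⟨k, by omega⟩ (by simp)
          refine ⟨some fun x => p ⟨k, by omega⟩ (x - H.τ) - H.s, ?_, fun m hm => ?_⟩
          · rintro _ ⟨⟩
            refine ⟨fun s => ?_, fun j hj x => ?_⟩
            · have := (h1.1 (s - H.τ)).shadow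
              rwa [shadow, sub_add_cancel] at this
            · rw [lowerShadow_succ]
              exact sub_le_sub_right (h1.2.2.2.2 j (Fin.lt_def.2 hj) _) _
          · have : m = ⟨k, by omega⟩ := Fin.ext (by simpa using hm)
            rw [this]; rfl
      obtain ⟨q, h1, h2, h3, h4, h5, h6⟩ := exists_trajectory hL hP ⟨k, hk⟩ hbo
      refine ⟨Function.update p ⟨k, hk⟩ q, fun n hn => ?_⟩
      have hne : ∀ m : Fin N, (m : ℕ) < k → Function.update p ⟨k, hk⟩ q m = p m := fun m hm =>
        Function.update_of_ne (fun h => by simp [h] at hm) _ _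
      rcases (Nat.lt_succ_iff.1 hn).lt_or_eq with hn | hn
      · rw [hne n hn]
        refine ⟨(hp n hn).1, fun m hm => ?_⟩
        rw [hne m (by omega)]
        exact (hp n hn).2 m hm
      · obtain rfl : n = ⟨k, hk⟩ := Fin.ext hn
        rw [Function.update_self]
        refine ⟨⟨h1, h2, h3, h4, h6⟩, fun m hm => ?_⟩
        rw [hne m (by simp at hm; omega)]
        exact h5 _ (hbo' m hm)
  obtain ⟨p, hp⟩ := key N le_rfl
  refine ⟨p, fun n => ?_, fun m n hmn x _ => ?_⟩
  · obtain ⟨⟨h1, h2, h3, ⟨g, hg, hgL⟩, -⟩, -⟩ := hp n n.2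
    have hbd : ∀ x, deriv (p n) x ∈ Icc 0 H.vMax ∧ acceleration (p n) x ∈ Icc H.aMin H.aMax :=
      fun x => (h1 x).bounds x le_rfl
    have hm : RegularMotion (p n) (deriv (p n)) (acceleration (p n)) := (h1 0).motion
    have hk : p n ∈ H.kinematic := ⟨hm.isTrajectory fun x => (hbd x).2, hbd⟩
    -- An earlier arrival at `L` would force `p n` to stand still at `L` up to time `g`, against its
    -- positive speed there.
    refine ⟨⟨hk, h2, h3⟩, hk, g, hg, IsLeast.isGLB ⟨hgL.ge, fun x hx => ?_⟩⟩
    by_contra! hlt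
    refine ((h1 g).speed_pos g le_rfl hgL.ge).not_ge ?_
    refine derivative_le_of_touch_right_end (hasDerivAt_const g H.L) (hm.hasDerivAt g) hlt
      (fun y hy => ?_) hgL.symm
    exact (show H.L ≤ p n x from hx).trans (hm.monotoneOn convex_univ (fun z _ => (hbd z).1.1) (mem_univ x)
      (mem_univ y) hy.1)
  · have := (hp n n.2).2 m hmn x
    linarith

/-! ### Necessity of properness and success of the heuristic -/

theorem entrySet_speed_mem {v₀ t₀ : ℝ} {p : ℝ → ℝ} (hp : p ∈ H.entrySet v₀ t₀) :
    v₀ ∈ Icc 0 H.vMax := hp.2.2 ▸ (hp.1.2 t₀).1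

/-- The boundary condition for two vehicles holds up to a time up to which there are safe
trajectories for them and the vehicles between them. -/
theorem lowerBound_le_upperShadow_of_safe {p : Fin N → ℝ → ℝ} {n : Fin N} {T : ℝ}
    (hp : ∀ k ≤ n, p k ∈ H.entrySet (v k) (t k))
    (hs : ∀ j k : Fin N, (j : ℕ) + 1 = k → k ≤ n → H.SafeOn (Iic T) (p j) (p k))
    {m : Fin N} (hmn : m ≤ n) {x : ℝ} (hx : x ≤ T) :
    H.lowerBound ⟨0, v n, t n⟩ x ≤ H.upperShadow v t n m x := by
  have key : ∀ (d : ℕ) (m : Fin N), (m : ℕ) + d = n → p n x ≤ p m (x - d * H.τ) - d * H.s := by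
    intro d
    induction d with
    | zero =>
      intro m hm
      obtain rfl : m = n := Fin.ext hm
      simp
    | succ d ih =>
      intro m hm
      have h1 := ih ⟨m + 1, by omega⟩ (by simp; omega)
      have hd : 0 ≤ d * H.τ := mul_nonneg d.cast_nonneg H.τ_nonneg
      -- The delays only move the evaluation time back, so it stays in the range where safety is
      -- assumed.
      have h2 := hs m ⟨m + 1, by omega⟩ rfl (Fin.le_def.2 (by simp; omega)) (x - d * H.τ)
        (mem_Iic.2 (by linarith))
      have h3 : x - ((d + 1 : ℕ) : ℝ) * H.τ = x - d * H.τ - H.τ := by push_cast; ring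
      rw [h3]
      push_cast
      linarith
  have h1 := key (n - m) m (by have := Fin.le_def.1 hmn; omega)
  rw [Nat.cast_sub (Fin.le_def.1 hmn)] at h1
  have hpn := hp n le_rfl
  have hpm := hp m hmn
  have h2 := H.lowerBound_le (x := ⟨0, v n, t n⟩) hpn.1.1.motion (entrySet_speed_mem hpn)
    hpn.1.2 hpn.2.1 hpn.2.2 x
  have h3 := H.le_upperBound (x := ⟨0, v m, t m⟩) hpm.1.1.motion (entrySet_speed_mem hpm)
    hpm.1.2 hpm.2.1 hpm.2.2 (x - ((n : ℝ) - m) * H.τ)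
  have h4 := H.upperBound_shift ⟨0, v m, t m⟩ (((m : ℝ) - n) * H.s) (((n : ℝ) - m) * H.τ) x
  simp only [zero_add] at h4
  rw [upperShadow, h4]
  linarith

theorem proper_of_feasibleSet_nonempty (h : (H.feasibleSet v t).Nonempty) : H.Proper v t := by
  obtain ⟨p, hp, hs⟩ := h
  refine proper_iff.2 ⟨fun n => entrySet_speed_mem (hp n).1, fun m n hmn x => ?_⟩
  exact lowerBound_le_upperShadow_of_safe (fun k _ => (hp k).1)
    (fun j k hjk _ y _ => hs j k hjk y (mem_univ y)) hmn.le le_rfl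

theorem SafeArrival.speed_mem (h : H.SafeArrival v t) (n : Fin N) : v n ∈ Icc 0 H.vMax := by
  obtain ⟨p, hp, -⟩ := h n
  exact entrySet_speed_mem (hp n le_rfl)

/-- At time `t n - τ` the leader is at least `s > 0` past the entry, where it was at time `t m`;
being monotone, it entered earlier. -/
theorem SafeArrival.time_le (h : H.SafeArrival v t) {m n : Fin N} (hmn : (m : ℕ) + 1 = n) :
    t m + H.τ ≤ t n := by
  obtain ⟨p, hp, hs⟩ := h n
  have hle : m ≤ n := Fin.le_def.2 (by omega)
  have h1 := hs m n hmn le_rfl (t n) (mem_Iic.2 le_rfl)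
  rw [(hp n le_rfl).2.1] at h1
  have hpm := hp m hle
  by_contra! hlt
  have h2 := hpm.1.1.motion.monotoneOn convex_univ (fun z _ => (hpm.1.2 z).1.1)
    (mem_univ (t n - H.τ)) (mem_univ (t m)) (by linarith)
  rw [hpm.2.1] at h2
  linarith [H.s_pos]

theorem drop_ofFn_eq_cons {α : Type*} (f : Fin N → α) {k : ℕ} (hk : k < N) :
    (List.ofFn f).drop k = f ⟨k, hk⟩ :: (List.ofFn f).drop (k + 1) := by
  rw [List.drop_eq_getElem_cons (by simpa using hk), List.getElem_ofFn]

/-- The room is carried along the list as in the construction of feasible trajectories. Safe arrival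
guarantees that the shadow has started when the next vehicle enters. -/
theorem Proper.shootList_isSome
    (hL : H.vMax ^ 2 / (2 * H.aMax) + 2 * (H.vMax ^ 2 / (-2 * H.aMin)) + H.s * ((N : ℝ) - 1)
      ≤ H.L) (hP : H.Proper v t) (hS : H.SafeArrival v t) (d : ℕ) :
    ∀ (k : ℕ) (bo : Option TrajSection), k + d = N →
      (∀ b ∈ bo, H.Admissible b ∧ (∀ hk : k < N, b.start ≤ t ⟨k, hk⟩) ∧
        ∀ j : Fin N, k ≤ j → ∀ x, b.start ≤ x → H.lowerShadow v t k j x ≤ b.pos x) →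
      (H.shootList H.aMin H.aMax H.aMin H.aMax bo
        ((List.ofFn fun n => (v n, t n)).drop k)).isSome := by
  induction d with
  | zero =>
    intro k bo hk _
    rw [List.drop_eq_nil_of_le (by simp; omega)]
    rfl
  | succ d ih =>
    intro k bo hkN hb
    have hk : k < N := by omega
    obtain ⟨p, hp, hpo, -, hpj⟩ := exists_shootVehicle hL hP ⟨k, hk⟩ (bo := bo)
      fun b h => ⟨(hb b h).1, (hb b h).2.1 hk, fun j hj => (hb b h).2.2 j hj⟩
    have hst : p.start = t ⟨k, hk⟩ := hpo.start_eq
    rw [drop_ofFn_eq_cons _ hk, shootList, hp, Option.bind_some, Option.isSome_map]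
    refine ih (k + 1) _ (by omega) ?_
    rintro _ ⟨⟩
    refine ⟨hpo.admissible.shadow, fun hk' => ?_, fun j hj x hx => ?_⟩
    · exact (congrArg (· + H.τ) hst).trans_le (hS.time_le rfl)
    · rw [lowerShadow_succ]
      refine sub_le_sub_right (hpj j (Fin.lt_def.2 hj) _ ?_) _
      rw [← hst]
      exact le_sub_iff_add_le.2 hx

/-- Each shadow stays below the delayed upper bounds of all vehicles before it, an invariant that
passes from one output to the next. Since the output for `n` lies above its own full-braking curve
from `t n` on, success of the heuristic orders the extreme curves there. -/
theorem SafeArrival.lowerBound_le_upperShadow (hS : H.SafeArrival v t) (d : ℕ) :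
    ∀ (k : ℕ) (bo : Option TrajSection), k + d = N →
      (∀ b ∈ bo, H.Admissible b ∧ ∀ hk : k < N, b.start ≤ t ⟨k, hk⟩) →
      (∀ m : Fin N, (m : ℕ) < k → ∃ b ∈ bo, ∀ x, b.start ≤ x →
        b.pos x ≤ H.upperShadow v t k m x) →
      (H.shootList H.aMin H.aMax H.aMin H.aMax bo
        ((List.ofFn fun n => (v n, t n)).drop k)).isSome →
      ∀ m n : Fin N, k ≤ n → m < n → ∀ x, t n ≤ x →
        H.lowerBound ⟨0, v n, t n⟩ x ≤ H.upperShadow v t n m x := by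
  induction d with
  | zero => exact fun k bo hk _ _ _ m n hn => absurd hn (by omega)
  | succ d ih =>
    intro k bo hkN hb hu hsome m n hn hmn
    have hk : k < N := by omega
    rw [drop_ofFn_eq_cons _ hk, shootList] at hsome
    obtain ⟨P, hP⟩ := Option.isSome_iff_exists.1 hsome
    obtain ⟨p, hp, hP⟩ := Option.bind_eq_some_iff.1 hP
    have hsome' : (H.shootList H.aMin H.aMax H.aMin H.aMax (some (H.shadow p))
        ((List.ofFn fun n => (v n, t n)).drop (k + 1))).isSome := by
      rw [← Option.isSome_map, hP]
      rfl
    have hv := hS.speed_mem ⟨k, hk⟩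
    have hpo := (shootVehicle_spec hv (fun b h => ⟨(hb b h).1, (hb b h).2 hk⟩) hp).1
    have hst : p.start = t ⟨k, hk⟩ := hpo.start_eq
    have hbd : ∀ y, t ⟨k, hk⟩ ≤ y →
        deriv p.pos y ∈ Icc 0 H.vMax ∧ acceleration p.pos y ∈ Icc H.aMin H.aMax :=
      fun y hy => hpo.admissible.bounds y (hst.trans_le hy)
    have hpu : ∀ m : Fin N, (m : ℕ) < k → ∀ y, t ⟨k, hk⟩ ≤ y →
        p.pos y ≤ H.upperShadow v t k m y := fun m hm y hy => by
      obtain ⟨b, hbo, h⟩ := hu m hm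
      exact (hpo.le_bound b hbo y hy).trans (h y (((hb b hbo).2 hk).trans hy))
    rcases hn.eq_or_lt with hn | hn
    · obtain rfl : n = ⟨k, hk⟩ := Fin.ext hn.symm
      intro x hx
      refine le_trans ?_ (hpu m (Fin.lt_def.1 hmn) x hx)
      exact H.lowerBound_le_of_time_le (x := ⟨0, v ⟨k, hk⟩, t ⟨k, hk⟩⟩)
        hpo.admissible.motion.toMotion hv hbd hpo.loc_eq hpo.speed_eq hx
    · refine ih (k + 1) _ (by omega) ?_ (fun m hm => ⟨_, rfl, fun x hx => ?_⟩) hsome' m n hn hmn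
      · rintro _ ⟨⟩
        exact ⟨hpo.admissible.shadow, fun hk' =>
          (congrArg (· + H.τ) hst).trans_le (hS.time_le rfl)⟩
      · rw [upperShadow_succ]
        have hx' : t ⟨k, hk⟩ ≤ x - H.τ := by
          rw [← hst]
          exact le_sub_iff_add_le.2 hx
        refine sub_le_sub_right ?_ _
        rcases (Nat.lt_succ_iff.1 hm).lt_or_eq with hm | hm
        · exact hpu m hm _ hx'
        · obtain rfl : m = ⟨k, hk⟩ := Fin.ext hm
          refine le_trans ?_ (congrFun (upperShadow_self (H := H) (v := v) (t := t) ⟨k, hk⟩) _).ge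
          rw [H.upperBound_eq_forwardTemplate (x := ⟨0, v ⟨k, hk⟩, t ⟨k, hk⟩⟩) hv hx']
          exact H.le_forwardTemplate (x := ⟨0, v ⟨k, hk⟩, t ⟨k, hk⟩⟩)
            hpo.admissible.motion.toMotion hv.2 hbd hpo.loc_eq hpo.speed_eq hx'

/-- The time axis splits at `t n`: before it the safe arrival trajectories give the inequality,
after it the shooting outputs do. -/
theorem SafeArrival.proper_of_isSome (hS : H.SafeArrival v t)
    (h : (H.shootingHeuristic H.aMin H.aMax H.aMin H.aMax v t).isSome) : H.Proper v t := by
  refine proper_iff.2 ⟨hS.speed_mem, fun m n hmn x => ?_⟩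
  rcases le_total x (t n) with hx | hx
  · obtain ⟨p, hp, hs⟩ := hS n
    exact lowerBound_le_upperShadow_of_safe hp hs hmn.le hx
  · exact hS.lowerBound_le_upperShadow N 0 none (by omega) (by simp) (by simp) h
      m n (Nat.zero_le _) hmn x hx

end vehicles

end Highway

end

theorem mainTheorem1 (H : Highway) (N : ℕ) (v t : Fin N → ℝ)
    (hL : H.vMax ^ 2 / (2 * H.aMax) + 2 * (H.vMax ^ 2 / (-2 * H.aMin)) + H.s * ((N : ℝ) - 1)
      ≤ H.L) :
    ((H.feasibleSet v t).Nonempty ↔ H.Proper v t) ∧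
    (H.SafeArrival v t →
      ((H.shootingHeuristic H.aMin H.aMax H.aMin H.aMax v t).isSome ↔
        (H.feasibleSet v t).Nonempty)) := by
  refine ⟨⟨Highway.proper_of_feasibleSet_nonempty, fun h => h.feasibleSet_nonempty hL⟩,
    fun hS => ⟨fun h => (hS.proper_of_isSome h).feasibleSet_nonempty hL, fun h => ?_⟩⟩
  exact (Highway.proper_of_feasibleSet_nonempty h).shootList_isSome hL hS N 0 none (by omega)
    (by simp)
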